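/- **Setting.** Let $\mathrm{Term}$ be the set of untyped $\lambda$-terms (de Bruijn indices). A reduction sequence $p:\mathrm{RedSeq}(M,N)$ is a finite composable list of one-step $\beta\eta$-reductions and formal inverses of such; $p\cdot q$ is concatenation, so that $(p\cdot q)\cdot r=p\cdot(q\cdot r)$ literally. An *extensional Kan complex* $K$ is a simplicial set with a chosen filler for every horn, a set $[K\to K]$ of endofunctions of the vertex set $|K|$ containing all functions $x\mapsto\llbracket M\rrbracket_{\rho[0\mapsto x]}$, and maps $F:|K|\to[K\to K]$, $G:[K\to K]\to|K|$ with $F(G(f))=f$, $G(F(x))=x$; here $\llbracket \mathtt{var}\,n\rrbracket_\rho=\rho(n)$, $\llbracket MN\rrbracket_\rho=F(\llbracket M\rrbracket_\rho)(\llbracket N\rrbracket_\rho)$, $\llbracket\lambda M\rrbracket_\rho=G(x\mapsto\llbracket M\rrbracket_{\rho[0\mapsto x]})$ for $\rho:\mathbb N\to|K|$. A *2-cell* $f\Rightarrow g$ between parallel edges $f,g:x\to y$ is a 2-simplex with $d_2=f$, $d_1=g$, $d_0$ degenerate on $y$. A *3-cell* between 2-cells $\alpha,\beta:f\Rightarrow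 g$ is a 3-simplex with $d_3=\alpha$, $d_2=\beta$, $d_1=s_1g$ and $d_0$ degenerate on $y$. The composite $f\cdot g$ of edges is the new face of the chosen filler of the inner horn on $f,g$. Vertical composition and inversion of 2-cells, left and right whiskering $\mathrm{wl}(f,\eta)$, $\mathrm{wr}(\eta,g)$ (both also written $\ast$), the left unitor $\mathrm{id}\cdot f\Rightarrow f$ and the associator $\mathrm{ass}(f,g,h):(f\cdot g)\cdot h\Rightarrow f\cdot(g\cdot h)$ are obtained in the standard way from chosen fillers of 3-dimensional inner horns. The filler used first for $\mathrm{ass}(f,g,h)$ has faces the composition triangles of $(f,g)$, $(f\cdot g,h)$, $(g,h)$; its remaining face is a triangle $T(f,g,h)$ with edges $f$, $g\cdot h$, $(f\cdot g)\cdot h$, and $\mathrm{ass}(f,g,h)$ compares the long edges of $T(f,g,h)$ and of the composition triangle of $f,\,g\cdot h$. $K$ is *front-seed coherent* if it carries two further families of chosen 3-cells. * (FS1) For all edges $\alpha:a\to b$, $\beta,\gamma:b\to c$, $\delta:c\to d$ and 2-cells $\eta:\beta\Rightarrow\gamma$, a 3-cell $$\mathrm{wr}(\mathrm{wl}(\alpha,\eta),\delta)\Longrightarrow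 \mathrm{ass}(\alpha,\beta,\delta)\cdot\mathrm{wl}(\alpha,\mathrm{wr}(\eta,\delta))\cdot\mathrm{ass}(\alpha,\gamma,\delta)^{-1}.$$ * (FS2) For all composable edges $p,q,r,s$, a 3-cell from the inner-right-front 2-cell $q\cdot(r\cdot s)\Rightarrow q\cdot(r\cdot s)$ to the reflexive 2-cell. The inner-right-front 2-cell is obtained by moving the long edge of $T(q,r,s)$ along $\mathrm{ass}(q,r,s)$ (with a chosen filler) and comparing the resulting triangle with the composition triangle of $q$ and $r\cdot s$. *Interpretation.* Fix $\rho$. A $\beta\eta$-step $M\to N$ forces $\llbracket M\rrbracket_\rho=\llbracket N\rrbracket_\rho$ and is interpreted by the degenerate edge, an inverse step by its chosen inverse edge, and a reduction sequence $p$ by the edge $\llbracket p\rrbracket$ given by recursion: the empty sequence by the degenerate edge, a first step $e$ followed by $p'$ by $\llbracket e\rrbracket\cdot\llbracket p'\rrbracket$. There is a 2-cell $c_{p,q}:\llbracket p\rrbracket\cdot\llbracket q\rrbracket\Rightarrow\llbracket p\cdot q\rrbracket$, given by recursion on $p$: the left unitor if $p$ is empty, and $\mathrm{ass}(\llbracket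 e\rrbracket,\llbracket p'\rrbracket,\llbracket q\rrbracket)\cdot\mathrm{wl}(\llbracket e\rrbracket,c_{p',q})$ if $p$ is $e$ followed by $p'$. An equality of reduction sequences gives a degenerate *equality-generated* 2-cell. The *structural associator shell* of $p,q,r$ is $$S(p,q,r)=\bigl(\mathrm{wr}(c_{p,q},\llbracket r\rrbracket)\cdot c_{p\cdot q,r}\bigr)^{-1}\cdot\mathrm{ass}(\llbracket p\rrbracket,\llbracket q\rrbracket,\llbracket r\rrbracket)\cdot\bigl(\mathrm{wl}(\llbracket p\rrbracket,c_{q,r})\cdot c_{p,q\cdot r}\bigr):\llbracket(p\cdot q)\cdot r\rrbracket\Rightarrow\llbracket p\cdot(q\cdot r)\rrbracket .$$ Write $p\star\theta=c_{p,q}^{-1}\cdot\mathrm{wl}(\llbracket p\rrbracket,\theta)\cdot c_{p,q'}$ for $\theta:\llbracket q\rrbracket\Rightarrow\llbracket q'\rrbracket$, and $\theta\star s=c_{q,s}^{-1}\cdot\mathrm{wr}(\theta,\llbracket s\rrbracket)\cdot c_{q',s}$. Explicit syntactic 2-cells between reduction sequences are generated by reflexivity, symmetry, transitivity, left and right whiskering,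 horizontal composition, associators and unitors; they are interpreted constructor by constructor, whiskering by $\star$, syntactic associators and unitors by equality-generated 2-cells. **Theorem (front-seed sufficiency).** Let $K$ be a front-seed coherent extensional Kan complex and $\rho$ an environment. 1. For all composable reduction sequences $p,q,r$ there is a 3-cell from $S(p,q,r)$ to the equality-generated 2-cell $\llbracket(p\cdot q)\cdot r\rrbracket\Rightarrow\llbracket p\cdot(q\cdot r)\rrbracket$. Consequently, any two parenthesizations $t,t'$ of the same finite nonempty list of composable reduction sequences are joined by a chain of elementary rebracketings, and for every elementary rebracketing, and for every such chain, the structural 2-cell between the parenthesized semantic composites (whiskered associators and their inverses, composed along the chain), transported along the comparisons (built from the $c_{p,q}$) of the parenthesized semantic composites with the interpretations of the literal concatenations, is connected by a 3-cell to the equality-generated 2-cell. 2. For all composable reduction sequences $p,q,r,s$ there is a 3-cell $$\mathrm{ass}(p\cdot q,r,s)\cdot\mathrm{ass}(p,q,r\cdot s)\Longrightarrow(\mathrm{ass}(p,q,r)\ast s)\cdot\mathrm{ass}(p,q\cdot r,s)\cdot(p\ast\mathrm{ass}(q,r,s)),$$ where $p,q,r,s$ stand for their interpretations and $\cdot$ between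 them for the composition of edges in $K$. 3. For all composable reduction sequences $p,q,r,s$, let $A$ and $B$ be the interpretations of the source $\mathrm{assoc}(p\cdot q,r,s)\cdot\mathrm{assoc}(p,q,r\cdot s)$ and of the target $(\mathrm{assoc}(p,q,r)\ast s)\cdot\mathrm{assoc}(p,q\cdot r,s)\cdot(p\ast\mathrm{assoc}(q,r,s))$ of the explicit syntactic pentagon, let $A'=S(p\cdot q,r,s)\cdot S(p,q,r\cdot s)$ be the structural source shell, and let $B'=E\cdot S(p,q\cdot r,s)\cdot(p\star S(q,r,s))$ be the mixed target shell, where $E:\llbracket((p\cdot q)\cdot r)\cdot s\rrbracket\Rightarrow\llbracket(p\cdot(q\cdot r))\cdot s\rrbracket$ is equality-generated. Then there are 3-cells $A\Rrightarrow B$ (interpreting the syntactic pentagon), $A\Rrightarrow A'$ (source bridge), $B\Rrightarrow B'$ (target bridge) and $A'\Rrightarrow B'$ (shell bridge). -/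

import Mathlib

universe u

namespace HigherLambda

/-! ## Untyped lambda terms (de Bruijn), reduction steps, reduction sequences -/

/-- Terms of the untyped lambda calculus with de Bruijn indices. -/
inductive Term : Type
  | var (n : ℕ) : Term
  | app (M N : Term) : Term
  | lam (M : Term) : Term

/-- Extend an environment-like function by a value at index `0`. -/
def consFn {D : Type*} (d : D) (ρ : ℕ → D) : ℕ → D
  | 0 => d
  | n + 1 => ρ n

namespace Term

/-- The lift of a renaming under a binder. -/
def upr (ξ : ℕ → ℕ) : ℕ → ℕ := consFn 0 (fun n => ξ n + 1)

/-- Renaming of the free indices. -/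
def rename : (ℕ → ℕ) → Term → Term
  | ξ, var n => var (ξ n)
  | ξ, app M N => app (rename ξ M) (rename ξ N)
  | ξ, lam M => lam (rename (upr ξ) M)

/-- `shift M` adds one to every free index of `M` (the shift of amount `1` at cutoff `0`). -/
def shift (M : Term) : Term := rename Nat.succ M

/-- The lift of a substitution under a binder. -/
def ups (σ : ℕ → Term) : ℕ → Term := consFn (var 0) (fun n => shift (σ n))

/-- Capture-avoiding parallel substitution. -/
def subst : (ℕ → Term) → Term → Term
  | σ, var n => σ n
  | σ, app M N => app (subst σ M) (subst σ N)
  | σ, lam M => lam (subst (ups σ) M)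

/-- `inst M N` is `M[N]`: index `0` is replaced by `N`, all other free indices go down by one. -/
def inst (M N : Term) : Term := subst (consFn N var) M

end Term

/-- One-step beta reduction, closed under subterm contexts. A step records its redex. -/
inductive BetaStep : Term → Term → Type
  | beta (M N : Term) : BetaStep (.app (.lam M) N) (M.inst N)
  | appL {M M' : Term} (s : BetaStep M M') (N : Term) : BetaStep (.app M N) (.app M' N)
  | appR (M : Term) {N N' : Term} (s : BetaStep N N') : BetaStep (.app M N) (.app M N')
  | lam {M M' : Term} (s : BetaStep M M') : BetaStep (.lam M) (.lam M')

/-- One-step eta reduction, closed under subterm contexts. A step records its redex. -/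
inductive EtaStep : Term → Term → Type
  | eta (M : Term) : EtaStep (.lam (.app M.shift (.var 0))) M
  | appL {M M' : Term} (s : EtaStep M M') (N : Term) : EtaStep (.app M N) (.app M' N)
  | appR (M : Term) {N N' : Term} (s : EtaStep N N') : EtaStep (.app M N) (.app M N')
  | lam {M M' : Term} (s : EtaStep M M') : EtaStep (.lam M) (.lam M')

/-- A beta-eta step is a beta step or an eta step. -/
inductive BetaEtaStep : Term → Term → Type
  | beta {M N : Term} (s : BetaStep M N) : BetaEtaStep M N
  | eta {M N : Term} (s : EtaStep M N) : BetaEtaStep M N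

/-- Reduction sequences: finite sequences of beta-eta steps and of formal inverses of such. -/
inductive RedSeq : Term → Term → Type
  | refl (M : Term) : RedSeq M M
  | step {M N P : Term} (s : BetaEtaStep M N) (p : RedSeq N P) : RedSeq M P
  | stepInv {M N P : Term} (s : BetaEtaStep N M) (p : RedSeq N P) : RedSeq M P

namespace RedSeq

/-- Literal concatenation of reduction sequences. -/
def concat : {M N P : Term} → RedSeq M N → RedSeq N P → RedSeq M P
  | _, _, _, refl _, q => q
  | _, _, _, step s p, q => step s (concat p q)
  | _, _, _, stepInv s p, q => stepInv s (concat p q)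

theorem concat_refl {M N : Term} (p : RedSeq M N) : p.concat (refl N) = p := by
  induction p with
  | refl => rfl
  | step s p ih => simp only [concat, ih]
  | stepInv s p ih => simp only [concat, ih]

theorem concat_assoc {M N P Q : Term} (p : RedSeq M N) (q : RedSeq N P) (r : RedSeq P Q) :
    (p.concat q).concat r = p.concat (q.concat r) := by
  induction p with
  | refl => rfl
  | step s p ih => simp only [concat, ih]
  | stepInv s p ih => simp only [concat, ih]

end RedSeq

/-- Explicit syntactic `2`-cells between parallel reduction sequences. -/
inductive Homotopy₂ : {M N : Term} → RedSeq M N → RedSeq M N → Type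
  | refl {M N : Term} (p : RedSeq M N) : Homotopy₂ p p
  | symm {M N : Term} {p q : RedSeq M N} (α : Homotopy₂ p q) : Homotopy₂ q p
  | trans {M N : Term} {p q r : RedSeq M N} (α : Homotopy₂ p q) (β : Homotopy₂ q r) :
      Homotopy₂ p r
  | whiskerLeft {M N P : Term} (p : RedSeq M N) {q q' : RedSeq N P} (α : Homotopy₂ q q') :
      Homotopy₂ (p.concat q) (p.concat q')
  | whiskerRight {M N P : Term} {p p' : RedSeq M N} (α : Homotopy₂ p p') (q : RedSeq N P) :
      Homotopy₂ (p.concat q) (p'.concat q)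
  | hcomp {M N P : Term} {p p' : RedSeq M N} {q q' : RedSeq N P} (α : Homotopy₂ p p')
      (β : Homotopy₂ q q') : Homotopy₂ (p.concat q) (p'.concat q')
  | assoc {M N P Q : Term} (p : RedSeq M N) (q : RedSeq N P) (r : RedSeq P Q) :
      Homotopy₂ ((p.concat q).concat r) (p.concat (q.concat r))
  | leftUnitor {M N : Term} (p : RedSeq M N) : Homotopy₂ ((RedSeq.refl M).concat p) p
  | rightUnitor {M N : Term} (p : RedSeq M N) : Homotopy₂ (p.concat (RedSeq.refl N)) p

/-- Source boundary of the explicit syntactic pentagon. -/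
def pentagonSource {M N P Q R : Term} (p : RedSeq M N) (q : RedSeq N P) (r : RedSeq P Q)
    (s : RedSeq Q R) :
    Homotopy₂ (((p.concat q).concat r).concat s) (p.concat (q.concat (r.concat s))) :=
  .trans (.assoc (p.concat q) r s) (.assoc p q (r.concat s))

/-- Target boundary of the explicit syntactic pentagon. -/
def pentagonTarget {M N P Q R : Term} (p : RedSeq M N) (q : RedSeq N P) (r : RedSeq P Q)
    (s : RedSeq Q R) :
    Homotopy₂ (((p.concat q).concat r).concat s) (p.concat (q.concat (r.concat s))) :=
  .trans (.trans (.whiskerRight (.assoc p q r) s) (.assoc p (q.concat r) s))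
    (.whiskerLeft p (.assoc q r s))

/-! ## Parenthesizations of finite composites of reduction sequences -/

/-- A nonempty finite list of composable reduction sequences. -/
inductive Factors : Term → Term → Type
  | one {M N : Term} (p : RedSeq M N) : Factors M N
  | cons {M N P : Term} (p : RedSeq M N) (l : Factors N P) : Factors M P

/-- Juxtaposition of composable lists. -/
def Factors.append : {M N P : Term} → Factors M N → Factors N P → Factors M P
  | _, _, _, .one p, l => .cons p l
  | _, _, _, .cons p k, l => .cons p (k.append l)

/-- A parenthesized composite of finitely many composable reduction sequences. -/
inductive Paren : Term → Term → Type
  | leaf {M N : Term} (p : RedSeq M N) : Paren M N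
  | node {M N P : Term} (a : Paren M N) (b : Paren N P) : Paren M P

namespace Paren

/-- The list of factors of a parenthesized composite. -/
def factors : {M N : Term} → Paren M N → Factors M N
  | _, _, leaf p => .one p
  | _, _, node a b => a.factors.append b.factors

/-- The literal concatenation of all factors, carried out along the parenthesization. -/
def flat : {M N : Term} → Paren M N → RedSeq M N
  | _, _, leaf p => p
  | _, _, node a b => a.flat.concat b.flat

end Paren

/-- Elementary rebracketings: one associativity move, at any place of the composite. -/
inductive Rebracket : {M N : Term} → Paren M N → Paren M N → Type
  | assoc {M N P Q : Term} (a : Paren M N) (b : Paren N P) (c : Paren P Q) :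
      Rebracket (.node (.node a b) c) (.node a (.node b c))
  | assocInv {M N P Q : Term} (a : Paren M N) (b : Paren N P) (c : Paren P Q) :
      Rebracket (.node a (.node b c)) (.node (.node a b) c)
  | left {M N P : Term} {a a' : Paren M N} (m : Rebracket a a') (b : Paren N P) :
      Rebracket (.node a b) (.node a' b)
  | right {M N P : Term} (a : Paren M N) {b b' : Paren N P} (m : Rebracket b b') :
      Rebracket (.node a b) (.node a b')

theorem Rebracket.flat_eq {M N : Term} {t t' : Paren M N} (m : Rebracket t t') :
    t.flat = t'.flat := by
  induction m with
  | assoc a b c => exact RedSeq.concat_assoc _ _ _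
  | assocInv a b c => exact (RedSeq.concat_assoc _ _ _).symm
  | left m b ih => simp only [Paren.flat, ih]
  | right a m ih => simp only [Paren.flat, ih]

/-- Finite chains of elementary rebracketings. -/
inductive RebracketChain {M N : Term} : Paren M N → Paren M N → Type
  | nil (t : Paren M N) : RebracketChain t t
  | cons {t t' t'' : Paren M N} (m : Rebracket t t') (c : RebracketChain t' t'') :
      RebracketChain t t''

theorem RebracketChain.flat_eq {M N : Term} {t t' : Paren M N} (c : RebracketChain t t') :
    t.flat = t'.flat := by
  induction c with
  | nil t => rfl
  | cons m c ih => exact m.flat_eq.trans ih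

/-! ## Kan complexes with chosen horn fillers -/

/-- The set of `n`-simplices of a simplicial set. -/
abbrev Simp (X : SSet.{u}) (n : ℕ) : Type u := X.obj (Opposite.op (SimplexCategory.mk n))

/-- The matching condition `d_{k-1} x_j = d_j x_k` (`j < k`, both different from `i`) for the
faces of an `(n+1)`-dimensional horn with missing face `i`; it is empty for `n = 0`. -/
def HornCompatible {X : SSet.{u}} : {n : ℕ} → {i : Fin (n + 2)} →
    (∀ j : Fin (n + 2), j ≠ i → Simp X n) → Prop
  | 0, _, _ => True
  | n + 1, i, face => ∀ (j k : Fin (n + 3)) (hj : j ≠ i) (hk : k ≠ i) (hjk : j < k),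
      X.δ (k.pred (Fin.ne_zero_of_lt hjk)) (face j hj) =
        X.δ (j.castPred (Fin.ne_last_of_lt hjk)) (face k hk)

/-- An `(n+1)`-dimensional horn in `X` with missing face `i`. -/
structure Horn (X : SSet.{u}) (n : ℕ) (i : Fin (n + 2)) where
  face : ∀ j : Fin (n + 2), j ≠ i → Simp X n
  compat : HornCompatible face

/-- A choice of a filler for every horn of the simplicial set `X`. -/
structure KanStructure (X : SSet.{u}) where
  fill : ∀ {n : ℕ} {i : Fin (n + 2)}, Horn X n i → Simp X (n + 1)
  fill_face : ∀ {n : ℕ} {i : Fin (n + 2)} (h : Horn X n i) (j : Fin (n + 2)) (hj : j ≠ i),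
    X.δ j (fill h) = h.face j hj

section Cells

variable {X : SSet.{u}}

/-- A `3`-simplex with vertices `x₀, x₁, x₂, x₃` and four prescribed `2`-dimensional faces. -/
structure Tetrahedron {x₀ x₁ x₂ x₃ : Simp X 0}
    {e₀₁ : SSet.Edge x₀ x₁} {e₀₂ : SSet.Edge x₀ x₂} {e₀₃ : SSet.Edge x₀ x₃}
    {e₁₂ : SSet.Edge x₁ x₂} {e₁₃ : SSet.Edge x₁ x₃} {e₂₃ : SSet.Edge x₂ x₃}
    (t₀₁₂ : SSet.Edge.CompStruct e₀₁ e₁₂ e₀₂) (t₀₁₃ : SSet.Edge.CompStruct e₀₁ e₁₃ e₀₃)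
    (t₀₂₃ : SSet.Edge.CompStruct e₀₂ e₂₃ e₀₃) (t₁₂₃ : SSet.Edge.CompStruct e₁₂ e₂₃ e₁₃) where
  simplex : Simp X 3
  d₃ : X.δ 3 simplex = t₀₁₂.simplex
  d₂ : X.δ 2 simplex = t₀₁₃.simplex
  d₁ : X.δ 1 simplex = t₀₂₃.simplex
  d₀ : X.δ 0 simplex = t₁₂₃.simplex

/-- Semantic `2`-cells `f ⇒ g` between parallel edges: `2`-simplices with `d₂ = f`, `d₁ = g` and
degenerate `d₀`. -/
abbrev Cell₂ {x y : Simp X 0} (f g : SSet.Edge x y) : Type u :=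
  SSet.Edge.CompStruct f (SSet.Edge.id y) g

/-- The reflexive `2`-cell of an edge (a degenerate `2`-simplex). -/
abbrev Cell₂.refl {x y : Simp X 0} (f : SSet.Edge x y) : Cell₂ f f :=
  SSet.Edge.CompStruct.compId f

/-- The `2`-cell generated by an equality of edges (a degenerate `2`-simplex). -/
def Cell₂.ofEq {x y : Simp X 0} {f g : SSet.Edge x y} (h : f = g) : Cell₂ f g :=
  SSet.Edge.CompStruct.ofEq (Cell₂.refl f) rfl rfl (congrArg SSet.Edge.edge h)

/-- Semantic `3`-cells between parallel `2`-cells: `3`-simplices with `d₃ = α`, `d₂ = β` and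
degenerate `d₁`, `d₀`, i.e. simplicial homotopies relative to the boundary. -/
abbrev Cell₃ {x y : Simp X 0} {f g : SSet.Edge x y} (α β : Cell₂ f g) : Type u :=
  Tetrahedron α β (Cell₂.refl g) (SSet.Edge.CompStruct.idCompId y)

end Cells

namespace KanStructure

variable {X : SSet.{u}} (K : KanStructure X)

/-- The horn `d₂ = f`, `d₀ = g` with missing face `1`. -/
def horn₂₁ {x y z : Simp X 0} (f : SSet.Edge x y) (g : SSet.Edge y z) : Horn X 1 1 where
  face j _ := ![g.edge, g.edge, f.edge] j
  compat := by
    intro j k hj hk hjk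
    fin_cases j <;> fin_cases k <;>
      first | exact (hj rfl).elim | exact (hk rfl).elim | exact absurd hjk (by decide) | skip
    exact g.src_eq.trans f.tgt_eq.symm

/-- The horn `d₂ = f`, `d₁ = g` with missing face `0`. -/
def horn₂₀ {x y z : Simp X 0} (f : SSet.Edge x y) (g : SSet.Edge x z) : Horn X 1 0 where
  face j _ := ![g.edge, g.edge, f.edge] j
  compat := by
    intro j k hj hk hjk
    fin_cases j <;> fin_cases k <;>
      first | exact (hj rfl).elim | exact (hk rfl).elim | exact absurd hjk (by decide) | skip
    exact g.src_eq.trans f.src_eq.symm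

/-- Composition of edges: the missing face of the chosen filler of an inner horn. -/
def comp {x y z : Simp X 0} (f : SSet.Edge x y) (g : SSet.Edge y z) : SSet.Edge x z :=
  SSet.Edge.mk (X.δ 1 (K.fill (horn₂₁ f g)))
    (by
      have h := SSet.δ_comp_δ_apply (S := X) (n := 0) (i := 1) (j := 1) le_rfl (K.fill (horn₂₁ f g))
      exact h.symm.trans ((congrArg _ (K.fill_face (horn₂₁ f g) 2 (by decide))).trans f.src_eq))
    (by
      have h := SSet.δ_comp_δ_apply (S := X) (i := 0) (j := 0) le_rfl (K.fill (horn₂₁ f g))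
      exact h.trans ((congrArg _ (K.fill_face (horn₂₁ f g) 0 (by decide))).trans g.tgt_eq))

/-- The composition triangle of two composable edges. -/
def compTri {x y z : Simp X 0} (f : SSet.Edge x y) (g : SSet.Edge y z) :
    SSet.Edge.CompStruct f g (K.comp f g) :=
  SSet.Edge.CompStruct.mk (K.fill (horn₂₁ f g))
    (K.fill_face (horn₂₁ f g) 2 (by decide)) (K.fill_face (horn₂₁ f g) 0 (by decide)) rfl

/-- The inverse of an edge: the missing face of the chosen filler of the outer horn with
`d₂ = f` and `d₁` degenerate. -/
def symm {x y : Simp X 0} (f : SSet.Edge x y) : SSet.Edge y x :=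
  SSet.Edge.mk (X.δ 0 (K.fill (horn₂₀ f (SSet.Edge.id x))))
    (by
      have h := SSet.δ_comp_δ_apply (S := X) (i := 0) (j := 1) (by decide)
        (K.fill (horn₂₀ f (SSet.Edge.id x)))
      exact h.symm.trans ((congrArg _ (K.fill_face (horn₂₀ f (SSet.Edge.id x)) 2
        (by decide))).trans f.tgt_eq))
    (by
      have h := SSet.δ_comp_δ_apply (S := X) (i := 0) (j := 0) le_rfl
        (K.fill (horn₂₀ f (SSet.Edge.id x)))
      exact h.symm.trans ((congrArg _ (K.fill_face (horn₂₀ f (SSet.Edge.id x)) 1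
        (by decide))).trans (SSet.Edge.id x).tgt_eq))

section Fillers

variable {x₀ x₁ x₂ x₃ : Simp X 0}
  {e₀₁ : SSet.Edge x₀ x₁} {e₀₂ : SSet.Edge x₀ x₂} {e₀₃ : SSet.Edge x₀ x₃}
  {e₁₂ : SSet.Edge x₁ x₂} {e₁₃ : SSet.Edge x₁ x₃} {e₂₃ : SSet.Edge x₂ x₃}

/-- The `3`-dimensional horn with missing face `1`. -/
def horn₃₁ (t₀₁₂ : SSet.Edge.CompStruct e₀₁ e₁₂ e₀₂) (t₀₁₃ : SSet.Edge.CompStruct e₀₁ e₁₃ e₀₃)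
    (t₁₂₃ : SSet.Edge.CompStruct e₁₂ e₂₃ e₁₃) : Horn X 2 1 where
  face j _ := ![t₁₂₃.simplex, t₁₂₃.simplex, t₀₁₃.simplex, t₀₁₂.simplex] j
  compat := by
    intro j k hj hk hjk
    fin_cases j <;> fin_cases k <;>
      first | exact (hj rfl).elim | exact (hk rfl).elim | exact absurd hjk (by decide) | skip
    · exact t₁₂₃.d₁.trans t₀₁₃.d₀.symm
    · exact t₁₂₃.d₂.trans t₀₁₂.d₀.symm
    · exact t₀₁₃.d₂.trans t₀₁₂.d₂.symm

/-- The `3`-dimensional horn with missing face `2`. -/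
def horn₃₂ (t₀₁₂ : SSet.Edge.CompStruct e₀₁ e₁₂ e₀₂) (t₀₂₃ : SSet.Edge.CompStruct e₀₂ e₂₃ e₀₃)
    (t₁₂₃ : SSet.Edge.CompStruct e₁₂ e₂₃ e₁₃) : Horn X 2 2 where
  face j _ := ![t₁₂₃.simplex, t₀₂₃.simplex, t₀₂₃.simplex, t₀₁₂.simplex] j
  compat := by
    intro j k hj hk hjk
    fin_cases j <;> fin_cases k <;>
      first | exact (hj rfl).elim | exact (hk rfl).elim | exact absurd hjk (by decide) | skip
    · exact t₁₂₃.d₀.trans t₀₂₃.d₀.symm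
    · exact t₁₂₃.d₂.trans t₀₁₂.d₀.symm
    · exact t₀₂₃.d₂.trans t₀₁₂.d₁.symm

/-- The missing face `1` of the chosen filler of a `3`-dimensional horn. -/
def fill₁ (t₀₁₂ : SSet.Edge.CompStruct e₀₁ e₁₂ e₀₂) (t₀₁₃ : SSet.Edge.CompStruct e₀₁ e₁₃ e₀₃)
    (t₁₂₃ : SSet.Edge.CompStruct e₁₂ e₂₃ e₁₃) : SSet.Edge.CompStruct e₀₂ e₂₃ e₀₃ :=
  SSet.Edge.CompStruct.mk (X.δ 1 (K.fill (horn₃₁ t₀₁₂ t₀₁₃ t₁₂₃)))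
    (by
      have h := SSet.δ_comp_δ_apply (S := X) (i := 1) (j := 2) (by decide)
        (K.fill (horn₃₁ t₀₁₂ t₀₁₃ t₁₂₃))
      exact h.symm.trans ((congrArg _ (K.fill_face (horn₃₁ t₀₁₂ t₀₁₃ t₁₂₃) 3
        (by decide))).trans t₀₁₂.d₁))
    (by
      have h := SSet.δ_comp_δ_apply (S := X) (i := 0) (j := 0) le_rfl
        (K.fill (horn₃₁ t₀₁₂ t₀₁₃ t₁₂₃))
      exact h.trans ((congrArg _ (K.fill_face (horn₃₁ t₀₁₂ t₀₁₃ t₁₂₃) 0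
        (by decide))).trans t₁₂₃.d₀))
    (by
      have h := SSet.δ_comp_δ_apply (S := X) (i := 1) (j := 1) le_rfl
        (K.fill (horn₃₁ t₀₁₂ t₀₁₃ t₁₂₃))
      exact h.symm.trans ((congrArg _ (K.fill_face (horn₃₁ t₀₁₂ t₀₁₃ t₁₂₃) 2
        (by decide))).trans t₀₁₃.d₁))

/-- The missing face `2` of the chosen filler of a `3`-dimensional horn. -/
def fill₂ (t₀₁₂ : SSet.Edge.CompStruct e₀₁ e₁₂ e₀₂) (t₀₂₃ : SSet.Edge.CompStruct e₀₂ e₂₃ e₀₃)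
    (t₁₂₃ : SSet.Edge.CompStruct e₁₂ e₂₃ e₁₃) : SSet.Edge.CompStruct e₀₁ e₁₃ e₀₃ :=
  SSet.Edge.CompStruct.mk (X.δ 2 (K.fill (horn₃₂ t₀₁₂ t₀₂₃ t₁₂₃)))
    (by
      have h := SSet.δ_comp_δ_apply (S := X) (i := 2) (j := 2) le_rfl
        (K.fill (horn₃₂ t₀₁₂ t₀₂₃ t₁₂₃))
      exact h.symm.trans ((congrArg _ (K.fill_face (horn₃₂ t₀₁₂ t₀₂₃ t₁₂₃) 3
        (by decide))).trans t₀₁₂.d₂))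
    (by
      have h := SSet.δ_comp_δ_apply (S := X) (i := 0) (j := 1) (by decide)
        (K.fill (horn₃₂ t₀₁₂ t₀₂₃ t₁₂₃))
      exact h.trans ((congrArg _ (K.fill_face (horn₃₂ t₀₁₂ t₀₂₃ t₁₂₃) 0
        (by decide))).trans t₁₂₃.d₁))
    (by
      have h := SSet.δ_comp_δ_apply (S := X) (i := 1) (j := 1) le_rfl
        (K.fill (horn₃₂ t₀₁₂ t₀₂₃ t₁₂₃))
      exact h.trans ((congrArg _ (K.fill_face (horn₃₂ t₀₁₂ t₀₂₃ t₁₂₃) 1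
        (by decide))).trans t₀₂₃.d₁))

end Fillers

/-- Vertical composition of `2`-cells. -/
def vcomp {x y : Simp X 0} {f g h : SSet.Edge x y} (α : Cell₂ f g) (β : Cell₂ g h) : Cell₂ f h :=
  K.fill₂ α β (SSet.Edge.CompStruct.idCompId y)

/-- Inverse of a `2`-cell. -/
def inv {x y : Simp X 0} {f g : SSet.Edge x y} (α : Cell₂ f g) : Cell₂ g f :=
  K.fill₁ α (Cell₂.refl f) (SSet.Edge.CompStruct.idCompId y)

/-- The comparison `2`-cell between the long edges of two triangles with the same short edges. -/
def compare {x y z : Simp X 0} {f : SSet.Edge x y} {g : SSet.Edge y z} {h h' : SSet.Edge x z}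
    (T : SSet.Edge.CompStruct f g h) (T' : SSet.Edge.CompStruct f g h') : Cell₂ h h' :=
  K.fill₁ T T' (Cell₂.refl g)

/-- Replace the long edge of a triangle along a `2`-cell. -/
def push {x y z : Simp X 0} {f : SSet.Edge x y} {g : SSet.Edge y z} {h h' : SSet.Edge x z}
    (T : SSet.Edge.CompStruct f g h) (α : Cell₂ h h') : SSet.Edge.CompStruct f g h' :=
  K.fill₂ T α (Cell₂.refl g)

/-- Left whiskering. -/
def wl {x y z : Simp X 0} (f : SSet.Edge x y) {g g' : SSet.Edge y z} (η : Cell₂ g g') :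
    Cell₂ (K.comp f g) (K.comp f g') :=
  K.fill₁ (K.compTri f g) (K.compTri f g') η

/-- Right whiskering. -/
def wr {x y z : Simp X 0} {f f' : SSet.Edge x y} (η : Cell₂ f f') (g : SSet.Edge y z) :
    Cell₂ (K.comp f g) (K.comp f' g) :=
  K.compare (K.compTri f g) (K.fill₂ η (K.compTri f' g) (SSet.Edge.CompStruct.idComp g))

/-- The triangle with edges `f`, `g·h`, `(f·g)·h`: the remaining face of the chosen tetrahedron
on the composition triangles of `(f, g)`, `(f·g, h)` and `(g, h)`. -/
def assTri {w x y z : Simp X 0} (f : SSet.Edge w x) (g : SSet.Edge x y) (h : SSet.Edge y z) :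
    SSet.Edge.CompStruct f (K.comp g h) (K.comp (K.comp f g) h) :=
  K.fill₂ (K.compTri f g) (K.compTri (K.comp f g) h) (K.compTri g h)

/-- The semantic associator `(f·g)·h ⇒ f·(g·h)`. -/
def ass {w x y z : Simp X 0} (f : SSet.Edge w x) (g : SSet.Edge x y) (h : SSet.Edge y z) :
    Cell₂ (K.comp (K.comp f g) h) (K.comp f (K.comp g h)) :=
  K.compare (K.assTri f g h) (K.compTri f (K.comp g h))

/-- The semantic left unitor `id·f ⇒ f`. -/
def lunit {x y : Simp X 0} (f : SSet.Edge x y) : Cell₂ (K.comp (SSet.Edge.id x) f) f :=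
  K.compare (K.compTri (SSet.Edge.id x) f) (SSet.Edge.CompStruct.idComp f)

/-- The inner-right-front face of the semantic pentagon on `p, q, r, s`, before it is whiskered
on the left by `p`. The associator tetrahedron of `q, r, s` has a front triangle with edges
`q`, `r·s`, `(q·r)·s`; its long edge is moved along `ass(q,r,s)` to `q·(r·s)`, and the result is
compared with the composition triangle of `q` and `r·s`. -/
def innerRightFront {a b c d e : Simp X 0} (_p : SSet.Edge a b) (q : SSet.Edge b c)
    (r : SSet.Edge c d) (s : SSet.Edge d e) :
    Cell₂ (K.comp q (K.comp r s)) (K.comp q (K.comp r s)) :=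
  K.compare (K.push (K.assTri q r s) (K.ass q r s)) (K.compTri q (K.comp r s))

/-- Left boundary composite of the structural pentagon. -/
def pentagonL {a b c d e : Simp X 0} (p : SSet.Edge a b) (q : SSet.Edge b c)
    (r : SSet.Edge c d) (s : SSet.Edge d e) :
    Cell₂ (K.comp (K.comp (K.comp p q) r) s) (K.comp p (K.comp q (K.comp r s))) :=
  K.vcomp (K.ass (K.comp p q) r s) (K.ass p q (K.comp r s))

/-- Right boundary composite of the structural pentagon. -/
def pentagonR {a b c d e : Simp X 0} (p : SSet.Edge a b) (q : SSet.Edge b c)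
    (r : SSet.Edge c d) (s : SSet.Edge d e) :
    Cell₂ (K.comp (K.comp (K.comp p q) r) s) (K.comp p (K.comp q (K.comp r s))) :=
  K.vcomp (K.vcomp (K.wr (K.ass p q r) s) (K.ass p (K.comp q r) s)) (K.wl p (K.ass q r s))

end KanStructure

/-! ## Extensional Kan complexes and the interpretation of terms -/

open Classical in
/-- Interpretation of terms in a set `D` with a space `S` of endofunctions and maps
`F : D → S`, `G : S → D`. The second alternative in the clause for `lam` is never used when
`S` contains the functions defined by terms, as is required in `ReflexiveKanComplex`. -/
noncomputable def interp {D : Type u} {S : Set (D → D)} (F : D → S) (G : S → D) :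
    Term → (ℕ → D) → D
  | .var n, ρ => ρ n
  | .app M N, ρ => (F (interp F G M ρ)).1 (interp F G N ρ)
  | .lam M, ρ =>
      if h : (fun x => interp F G M (consFn x ρ)) ∈ S then G ⟨_, h⟩ else ρ 0

/-- A reflexive Kan complex: a simplicial set with chosen horn fillers, a space `[K → K]` of
endofunctions of its set of vertices which contains the functions defined by terms, and maps
`F : |K| → [K → K]`, `G : [K → K] → |K|` with `F (G f) = f`. -/
structure ReflexiveKanComplex where
  X : SSet.{u}
  kan : KanStructure X
  funSpace : Set (Simp X 0 → Simp X 0)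
  F : Simp X 0 → funSpace
  G : funSpace → Simp X 0
  interp_mem : ∀ (M : Term) (ρ : ℕ → Simp X 0), (fun x => interp F G M (consFn x ρ)) ∈ funSpace
  F_G : ∀ f : funSpace, F (G f) = f

/-- An extensional Kan complex. -/
structure ExtensionalKanComplex extends ReflexiveKanComplex.{u} where
  G_F : ∀ x : Simp X 0, G (F x) = x

namespace ExtensionalKanComplex

variable (K : ExtensionalKanComplex.{u})

/-- Environments. -/
abbrev Env : Type u := ℕ → Simp K.X 0

/-- The interpretation of a term in an environment. -/
noncomputable def term (ρ : K.Env) (M : Term) : Simp K.X 0 := interp K.F K.G M ρ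

theorem term_app (ρ : K.Env) (M N : Term) :
    K.term ρ (.app M N) = (K.F (K.term ρ M)).1 (K.term ρ N) := rfl

theorem term_lam (ρ : K.Env) (M : Term) :
    K.term ρ (.lam M) = K.G ⟨fun x => K.term (consFn x ρ) M, K.interp_mem M ρ⟩ :=
  dif_pos (K.interp_mem M ρ)

theorem term_lam_congr {ρ ρ' : K.Env} {M M' : Term}
    (h : ∀ x, K.term (consFn x ρ) M = K.term (consFn x ρ') M') :
    K.term ρ (.lam M) = K.term ρ' (.lam M') := by
  rw [term_lam, term_lam]
  exact congrArg K.G (Subtype.ext (funext h))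

theorem term_rename (M : Term) : ∀ (ξ : ℕ → ℕ) (ρ : K.Env),
    K.term ρ (M.rename ξ) = K.term (fun n => ρ (ξ n)) M := by
  induction M with
  | var n => intro ξ ρ; rfl
  | app M N ihM ihN =>
    intro ξ ρ
    simp only [Term.rename, term_app, ihM, ihN]
  | lam M ih =>
    intro ξ ρ
    refine K.term_lam_congr fun x => ?_
    rw [ih]
    congr 1
    funext n
    cases n <;> rfl

theorem term_shift (M : Term) (ρ : K.Env) (x : Simp K.X 0) :
    K.term (consFn x ρ) M.shift = K.term ρ M :=
  K.term_rename M Nat.succ (consFn x ρ)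

theorem term_subst (M : Term) : ∀ (σ : ℕ → Term) (ρ : K.Env),
    K.term ρ (M.subst σ) = K.term (fun n => K.term ρ (σ n)) M := by
  induction M with
  | var n => intro σ ρ; rfl
  | app M N ihM ihN =>
    intro σ ρ
    simp only [Term.subst, term_app, ihM, ihN]
  | lam M ih =>
    intro σ ρ
    refine K.term_lam_congr fun x => ?_
    rw [ih]
    congr 1
    funext n
    cases n with
    | zero => rfl
    | succ n => exact K.term_shift (σ n) ρ x

theorem beta_sound {M N : Term} (s : BetaStep M N) : ∀ ρ : K.Env, K.term ρ M = K.term ρ N := by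
  induction s with
  | beta M N =>
    intro ρ
    rw [term_app, term_lam, K.F_G, Term.inst, term_subst]
    change K.term _ M = K.term _ M
    congr 1
    funext n
    cases n <;> rfl
  | appL s N ih => intro ρ; rw [term_app, term_app, ih]
  | appR M s ih => intro ρ; rw [term_app, term_app, ih]
  | lam s ih => intro ρ; exact K.term_lam_congr fun x => ih _

theorem eta_sound {M N : Term} (s : EtaStep M N) : ∀ ρ : K.Env, K.term ρ M = K.term ρ N := by
  induction s with
  | eta M =>
    intro ρ
    rw [term_lam]
    refine Eq.trans (congrArg K.G (Subtype.ext (funext fun x => ?_))) (K.G_F (K.term ρ M))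
    change (K.F (K.term (consFn x ρ) M.shift)).1 x = _
    rw [term_shift]
  | appL s N ih => intro ρ; rw [term_app, term_app, ih]
  | appR M s ih => intro ρ; rw [term_app, term_app, ih]
  | lam s ih => intro ρ; exact K.term_lam_congr fun x => ih _

theorem step_sound {M N : Term} (s : BetaEtaStep M N) (ρ : K.Env) :
    K.term ρ M = K.term ρ N := by
  cases s with
  | beta s => exact K.beta_sound s ρ
  | eta s => exact K.eta_sound s ρ

/-- The degenerate semantic `1`-cell of a beta-eta step. -/
noncomputable def stepEdge (ρ : K.Env) {M N : Term} (s : BetaEtaStep M N) :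
    SSet.Edge (K.term ρ M) (K.term ρ N) :=
  (SSet.Edge.id (K.term ρ M)).ofEq rfl (K.step_sound s ρ)

/-- The interpretation of a reduction sequence as a semantic `1`-cell. -/
noncomputable def seq (ρ : K.Env) : {M N : Term} → RedSeq M N →
    SSet.Edge (K.term ρ M) (K.term ρ N)
  | _, _, .refl M => SSet.Edge.id (K.term ρ M)
  | _, _, .step s p => K.kan.comp (K.stepEdge ρ s) (seq ρ p)
  | _, _, .stepInv s p => K.kan.comp (K.kan.symm (K.stepEdge ρ s)) (seq ρ p)

/-- The comparison `⟦p⟧·⟦q⟧ ⇒ ⟦p·q⟧` between the semantic composite and the interpretation of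
the concatenation, by recursion on `p`. -/
noncomputable def concatCell (ρ : K.Env) : {M N P : Term} → (p : RedSeq M N) →
    (q : RedSeq N P) → Cell₂ (K.kan.comp (K.seq ρ p) (K.seq ρ q)) (K.seq ρ (p.concat q))
  | _, _, _, .refl _, q => K.kan.lunit (K.seq ρ q)
  | _, _, _, .step s p, q =>
      K.kan.vcomp (K.kan.ass (K.stepEdge ρ s) (K.seq ρ p) (K.seq ρ q))
        (K.kan.wl (K.stepEdge ρ s) (concatCell ρ p q))
  | _, _, _, .stepInv s p, q =>
      K.kan.vcomp (K.kan.ass (K.kan.symm (K.stepEdge ρ s)) (K.seq ρ p) (K.seq ρ q))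
        (K.kan.wl (K.kan.symm (K.stepEdge ρ s)) (concatCell ρ p q))

/-- The `2`-cell generated by an equality of reduction sequences. -/
noncomputable def eqCell (ρ : K.Env) {M N : Term} {p q : RedSeq M N} (h : p = q) :
    Cell₂ (K.seq ρ p) (K.seq ρ q) :=
  Cell₂.ofEq (congrArg (K.seq ρ) h)

/-- The equality-generated associator comparison `⟦(p·q)·r⟧ ⇒ ⟦p·(q·r)⟧`, coming from the literal
equality of the two concatenations. -/
noncomputable def assocEqCell (ρ : K.Env) {M N P Q : Term} (p : RedSeq M N) (q : RedSeq N P)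
    (r : RedSeq P Q) :
    Cell₂ (K.seq ρ ((p.concat q).concat r)) (K.seq ρ (p.concat (q.concat r))) :=
  K.eqCell ρ (RedSeq.concat_assoc p q r)

/-- The structural associator shell `⟦(p·q)·r⟧ ⇒ ⟦p·(q·r)⟧`: the semantic associator of
`⟦p⟧, ⟦q⟧, ⟦r⟧` between the comparisons of `(⟦p⟧·⟦q⟧)·⟦r⟧` with `⟦(p·q)·r⟧` and of
`⟦p⟧·(⟦q⟧·⟦r⟧)` with `⟦p·(q·r)⟧`. -/
noncomputable def assocShell (ρ : K.Env) {M N P Q : Term} (p : RedSeq M N) (q : RedSeq N P)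
    (r : RedSeq P Q) :
    Cell₂ (K.seq ρ ((p.concat q).concat r)) (K.seq ρ (p.concat (q.concat r))) :=
  K.kan.vcomp
    (K.kan.vcomp
      (K.kan.inv (K.kan.vcomp (K.kan.wr (K.concatCell ρ p q) (K.seq ρ r))
        (K.concatCell ρ (p.concat q) r)))
      (K.kan.ass (K.seq ρ p) (K.seq ρ q) (K.seq ρ r)))
    (K.kan.vcomp (K.kan.wl (K.seq ρ p) (K.concatCell ρ q r))
      (K.concatCell ρ p (q.concat r)))

/-- Left whiskering of a `2`-cell between interpreted sequences by an interpreted sequence,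
between interpretations of concatenations. -/
noncomputable def seqWl (ρ : K.Env) {M N P : Term} (p : RedSeq M N) {q q' : RedSeq N P}
    (θ : Cell₂ (K.seq ρ q) (K.seq ρ q')) :
    Cell₂ (K.seq ρ (p.concat q)) (K.seq ρ (p.concat q')) :=
  K.kan.vcomp (K.kan.vcomp (K.kan.inv (K.concatCell ρ p q)) (K.kan.wl (K.seq ρ p) θ))
    (K.concatCell ρ p q')

/-- Right whiskering of a `2`-cell between interpreted sequences by an interpreted sequence,
between interpretations of concatenations. -/
noncomputable def seqWr (ρ : K.Env) {M N P : Term} {p p' : RedSeq M N}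
    (θ : Cell₂ (K.seq ρ p) (K.seq ρ p')) (q : RedSeq N P) :
    Cell₂ (K.seq ρ (p.concat q)) (K.seq ρ (p'.concat q)) :=
  K.kan.vcomp (K.kan.vcomp (K.kan.inv (K.concatCell ρ p q)) (K.kan.wr θ (K.seq ρ q)))
    (K.concatCell ρ p' q)

/-- The interpretation of explicit syntactic `2`-cells. -/
noncomputable def homotopy₂ (ρ : K.Env) : {M N : Term} → {p q : RedSeq M N} → Homotopy₂ p q →
    Cell₂ (K.seq ρ p) (K.seq ρ q)
  | _, _, _, _, .refl p => Cell₂.refl (K.seq ρ p)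
  | _, _, _, _, .symm α => K.kan.inv (homotopy₂ ρ α)
  | _, _, _, _, .trans α β => K.kan.vcomp (homotopy₂ ρ α) (homotopy₂ ρ β)
  | _, _, _, _, .whiskerLeft p α => K.seqWl ρ p (homotopy₂ ρ α)
  | _, _, _, _, .whiskerRight α q => K.seqWr ρ (homotopy₂ ρ α) q
  | _, _, _, _, .hcomp (p' := p') (q := q) α β =>
      K.kan.vcomp (K.seqWr ρ (homotopy₂ ρ α) q) (K.seqWl ρ p' (homotopy₂ ρ β))
  | _, _, _, _, .assoc p q r => K.assocEqCell ρ p q r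
  | _, _, _, _, .leftUnitor p => K.eqCell ρ (p := (RedSeq.refl _).concat p) (q := p) rfl
  | _, _, _, _, .rightUnitor p => K.eqCell ρ (RedSeq.concat_refl p)

/-- The structural source shell of the pentagon. -/
noncomputable def sourceShell (ρ : K.Env) {M N P Q R : Term} (p : RedSeq M N) (q : RedSeq N P)
    (r : RedSeq P Q) (s : RedSeq Q R) :
    Cell₂ (K.seq ρ (((p.concat q).concat r).concat s))
      (K.seq ρ (p.concat (q.concat (r.concat s)))) :=
  K.kan.vcomp (K.assocShell ρ (p.concat q) r s) (K.assocShell ρ p q (r.concat s))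

/-- The mixed target shell of the pentagon: the right-whiskered factor is the equality-generated
one, the two other factors are structural. -/
noncomputable def mixedTargetShell (ρ : K.Env) {M N P Q R : Term} (p : RedSeq M N)
    (q : RedSeq N P) (r : RedSeq P Q) (s : RedSeq Q R) :
    Cell₂ (K.seq ρ (((p.concat q).concat r).concat s))
      (K.seq ρ (p.concat (q.concat (r.concat s)))) :=
  K.kan.vcomp
    (K.kan.vcomp
      (K.eqCell ρ (congrArg (fun t => RedSeq.concat t s) (RedSeq.concat_assoc p q r)))
      (K.assocShell ρ p (q.concat r) s))
    (K.seqWl ρ p (K.assocShell ρ q r s))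

/-- The semantic composite of a parenthesized composite, along its parenthesization. -/
noncomputable def parenEdge (ρ : K.Env) : {M N : Term} → Paren M N →
    SSet.Edge (K.term ρ M) (K.term ρ N)
  | _, _, .leaf p => K.seq ρ p
  | _, _, .node a b => K.kan.comp (parenEdge ρ a) (parenEdge ρ b)

/-- The comparison of the semantic composite of a parenthesized composite with the interpretation
of its literal concatenation. -/
noncomputable def parenCell (ρ : K.Env) : {M N : Term} → (t : Paren M N) →
    Cell₂ (K.parenEdge ρ t) (K.seq ρ t.flat)
  | _, _, .leaf p => Cell₂.refl (K.seq ρ p)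
  | _, _, .node a b =>
      K.kan.vcomp
        (K.kan.vcomp (K.kan.wr (parenCell ρ a) (K.parenEdge ρ b))
          (K.kan.wl (K.seq ρ a.flat) (parenCell ρ b)))
        (K.concatCell ρ a.flat b.flat)

/-- The structural `2`-cell of an elementary rebracketing: a whiskered semantic associator or
its inverse. -/
noncomputable def rebracketCell (ρ : K.Env) : {M N : Term} → {t t' : Paren M N} →
    Rebracket t t' → Cell₂ (K.parenEdge ρ t) (K.parenEdge ρ t')
  | _, _, _, _, .assoc a b c => K.kan.ass (K.parenEdge ρ a) (K.parenEdge ρ b) (K.parenEdge ρ c)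
  | _, _, _, _, .assocInv a b c =>
      K.kan.inv (K.kan.ass (K.parenEdge ρ a) (K.parenEdge ρ b) (K.parenEdge ρ c))
  | _, _, _, _, .left m b => K.kan.wr (rebracketCell ρ m) (K.parenEdge ρ b)
  | _, _, _, _, .right a m => K.kan.wl (K.parenEdge ρ a) (rebracketCell ρ m)

/-- The structural `2`-cell of a chain of elementary rebracketings. -/
noncomputable def chainCell (ρ : K.Env) {M N : Term} : {t t' : Paren M N} →
    RebracketChain t t' → Cell₂ (K.parenEdge ρ t) (K.parenEdge ρ t')
  | _, _, .nil t => Cell₂.refl (K.parenEdge ρ t)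
  | _, _, .cons m c => K.kan.vcomp (K.rebracketCell ρ m) (chainCell ρ c)

/-- The shell of a `2`-cell between two parenthesized semantic composites: the induced `2`-cell
between the interpretations of the literal concatenations. -/
noncomputable def parenShell (ρ : K.Env) {M N : Term} {t t' : Paren M N}
    (θ : Cell₂ (K.parenEdge ρ t) (K.parenEdge ρ t')) :
    Cell₂ (K.seq ρ t.flat) (K.seq ρ t'.flat) :=
  K.kan.vcomp (K.kan.vcomp (K.kan.inv (K.parenCell ρ t)) θ) (K.parenCell ρ t')

end ExtensionalKanComplex

/-! ## Front-seed data -/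

/-- A front-seed coherent extensional Kan complex: an extensional Kan complex with chosen
`3`-cells comparing the two mixed whiskerings (`wlwr`) and contracting the inner-right-front
face of the semantic pentagon (`innerRightFrontContraction`). -/
structure FrontSeedCoherentExtensionalKanComplex extends ExtensionalKanComplex.{u} where
  wlwr : ∀ {a b c d : Simp X 0} (α : SSet.Edge a b) {β γ : SSet.Edge b c} (η : Cell₂ β γ)
    (δ : SSet.Edge c d),
    Cell₃ (kan.wr (kan.wl α η) δ)
      (kan.vcomp (kan.vcomp (kan.ass α β δ) (kan.wl α (kan.wr η δ))) (kan.inv (kan.ass α γ δ)))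
  innerRightFrontContraction : ∀ {a b c d e : Simp X 0} (p : SSet.Edge a b) (q : SSet.Edge b c)
    (r : SSet.Edge c d) (s : SSet.Edge d e),
    Cell₃ (kan.innerRightFront p q r s) (Cell₂.refl (kan.comp q (kan.comp r s)))

end HigherLambda

open HigherLambda

/-! The idea is to pass to homotopy classes, where a 3-cell becomes an equation. Triangles with
fixed edges are identified when they are homotopic relative to their boundary, and `Tet` records
which four classes bound a tetrahedron. Filling 4-dimensional horns gives two principles: in a
tetrahedron the class of one face is determined by the other three (`Tet.unique₁`, `Tet.unique₂`,
`Tet.unique₃`), and four suitable tetrahedra on five vertices force the fifth (`Tet.face₁`,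
`Tet.face₂`, `Tet.face₃`).

Consequently the edges from `x` to `y` form a groupoid under classes of 2-cells, and 2-cells act on
triangles through each edge (`push`, `pull`, `slide`). The action on the long edge is free and
transitive, so a 2-cell out of a composite is known once its effect on the composition triangle is
known. In this way each chosen operation is characterised independently of the fillers, and
naturality of the associator, interchange and the left unit laws become comparisons of tetrahedra.
The pentagon is the statement that the four associator tetrahedra on `f, g, h, k` other than the one
opposite vertex 1 force that one.

For reduction sequences the central result is `assoc_comparison`: the comparisons `c_{p,q}` turn the
semantic associator into the transport along `concat_assoc`. It is proved by induction on the first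
sequence, with the left unit laws as base and the pentagon as the step. Hence `S(p,q,r)` has the
class of an `eqToHom`. Naturality extends this to whiskered associators inside parenthesized
composites and to chains. All four boundaries in part 3 have the class of one `eqToHom`, so every
bridge exists; part 2 is the pentagon itself. -/

namespace HigherLambda

/-! ### Tetrahedra from 4-dimensional horns, and degenerate tetrahedra -/

section Tetrahedra

variable {X : SSet.{u}}

/-- This is the shape of the simplicial identity used in `HornCompatible`; for numerals `pred` and
`castPred` compute, so it gives each face equation of a missing face directly. -/
theorem δ_δ_of_lt {n : ℕ} (x : Simp X (n + 2)) {j k : Fin (n + 3)} (h : j < k) :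
    X.δ (k.pred (Fin.ne_zero_of_lt h)) (X.δ j x) =
      X.δ (j.castPred (Fin.ne_last_of_lt h)) (X.δ k x) := by
  have hle : j.castPred (Fin.ne_last_of_lt h) ≤ k.pred (Fin.ne_zero_of_lt h) := by
    show j.val ≤ k.val - 1
    exact Nat.le_sub_one_of_lt h
  have e := SSet.δ_comp_δ_apply (S := X) hle x
  rw [Fin.succ_pred, Fin.castSucc_castPred] at e
  exact e.symm

variable {x₀ x₁ x₂ x₃ x₄ : Simp X 0}
  {e₀₁ : SSet.Edge x₀ x₁} {e₀₂ : SSet.Edge x₀ x₂} {e₀₃ : SSet.Edge x₀ x₃} {e₀₄ : SSet.Edge x₀ x₄}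
  {e₁₂ : SSet.Edge x₁ x₂} {e₁₃ : SSet.Edge x₁ x₃} {e₁₄ : SSet.Edge x₁ x₄}
  {e₂₃ : SSet.Edge x₂ x₃} {e₂₄ : SSet.Edge x₂ x₄} {e₃₄ : SSet.Edge x₃ x₄}
  {t₀₁₂ : SSet.Edge.CompStruct e₀₁ e₁₂ e₀₂} {t₀₁₃ : SSet.Edge.CompStruct e₀₁ e₁₃ e₀₃}
  {t₀₁₄ : SSet.Edge.CompStruct e₀₁ e₁₄ e₀₄} {t₀₂₃ : SSet.Edge.CompStruct e₀₂ e₂₃ e₀₃}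
  {t₀₂₄ : SSet.Edge.CompStruct e₀₂ e₂₄ e₀₄} {t₀₃₄ : SSet.Edge.CompStruct e₀₃ e₃₄ e₀₄}
  {t₁₂₃ : SSet.Edge.CompStruct e₁₂ e₂₃ e₁₃} {t₁₂₄ : SSet.Edge.CompStruct e₁₂ e₂₄ e₁₄}
  {t₁₃₄ : SSet.Edge.CompStruct e₁₃ e₃₄ e₁₄} {t₂₃₄ : SSet.Edge.CompStruct e₂₃ e₃₄ e₂₄}

namespace KanStructure

variable (K : KanStructure X)

/-- The missing face `1` of a `4`-dimensional horn. -/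
def tetrahedron₁ (T₀ : Tetrahedron t₁₂₃ t₁₂₄ t₁₃₄ t₂₃₄) (T₂ : Tetrahedron t₀₁₃ t₀₁₄ t₀₃₄ t₁₃₄)
    (T₃ : Tetrahedron t₀₁₂ t₀₁₄ t₀₂₄ t₁₂₄) (T₄ : Tetrahedron t₀₁₂ t₀₁₃ t₀₂₃ t₁₂₃) :
    Tetrahedron t₀₂₃ t₀₂₄ t₀₃₄ t₂₃₄ :=
  let H : Horn X 3 1 :=
    { face := fun j _ => ![T₀.simplex, T₀.simplex, T₂.simplex, T₃.simplex, T₄.simplex] j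
      compat := by
        intro j k hj hk hjk
        fin_cases j <;> fin_cases k <;>
          first | exact (hj rfl).elim | exact (hk rfl).elim | exact absurd hjk (by decide) | skip
        · exact T₀.d₁.trans T₂.d₀.symm
        · exact T₀.d₂.trans T₃.d₀.symm
        · exact T₀.d₃.trans T₄.d₀.symm
        · exact T₂.d₂.trans T₃.d₂.symm
        · exact T₂.d₃.trans T₄.d₂.symm
        · exact T₃.d₃.trans T₄.d₃.symm }
  { simplex := X.δ 1 (K.fill H)
    d₃ := (δ_δ_of_lt (K.fill H) (j := 1) (k := 4) (by decide)).trans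
      ((congrArg _ (K.fill_face H 4 (by decide))).trans T₄.d₁)
    d₂ := (δ_δ_of_lt (K.fill H) (j := 1) (k := 3) (by decide)).trans
      ((congrArg _ (K.fill_face H 3 (by decide))).trans T₃.d₁)
    d₁ := (δ_δ_of_lt (K.fill H) (j := 1) (k := 2) (by decide)).trans
      ((congrArg _ (K.fill_face H 2 (by decide))).trans T₂.d₁)
    d₀ := (δ_δ_of_lt (K.fill H) (j := 0) (k := 1) (by decide)).symm.trans
      ((congrArg _ (K.fill_face H 0 (by decide))).trans T₀.d₀) }

/-- The missing face `2` of a `4`-dimensional horn. -/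
def tetrahedron₂ (T₀ : Tetrahedron t₁₂₃ t₁₂₄ t₁₃₄ t₂₃₄) (T₁ : Tetrahedron t₀₂₃ t₀₂₄ t₀₃₄ t₂₃₄)
    (T₃ : Tetrahedron t₀₁₂ t₀₁₄ t₀₂₄ t₁₂₄) (T₄ : Tetrahedron t₀₁₂ t₀₁₃ t₀₂₃ t₁₂₃) :
    Tetrahedron t₀₁₃ t₀₁₄ t₀₃₄ t₁₃₄ :=
  let H : Horn X 3 2 :=
    { face := fun j _ => ![T₀.simplex, T₁.simplex, T₁.simplex, T₃.simplex, T₄.simplex] j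
      compat := by
        intro j k hj hk hjk
        fin_cases j <;> fin_cases k <;>
          first | exact (hj rfl).elim | exact (hk rfl).elim | exact absurd hjk (by decide) | skip
        · exact T₀.d₀.trans T₁.d₀.symm
        · exact T₀.d₂.trans T₃.d₀.symm
        · exact T₀.d₃.trans T₄.d₀.symm
        · exact T₁.d₂.trans T₃.d₁.symm
        · exact T₁.d₃.trans T₄.d₁.symm
        · exact T₃.d₃.trans T₄.d₃.symm }
  { simplex := X.δ 2 (K.fill H)
    d₃ := (δ_δ_of_lt (K.fill H) (j := 2) (k := 4) (by decide)).trans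
      ((congrArg _ (K.fill_face H 4 (by decide))).trans T₄.d₂)
    d₂ := (δ_δ_of_lt (K.fill H) (j := 2) (k := 3) (by decide)).trans
      ((congrArg _ (K.fill_face H 3 (by decide))).trans T₃.d₂)
    d₁ := (δ_δ_of_lt (K.fill H) (j := 1) (k := 2) (by decide)).symm.trans
      ((congrArg _ (K.fill_face H 1 (by decide))).trans T₁.d₁)
    d₀ := (δ_δ_of_lt (K.fill H) (j := 0) (k := 2) (by decide)).symm.trans
      ((congrArg _ (K.fill_face H 0 (by decide))).trans T₀.d₁) }

/-- The missing face `3` of a `4`-dimensional horn. -/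
def tetrahedron₃ (T₀ : Tetrahedron t₁₂₃ t₁₂₄ t₁₃₄ t₂₃₄) (T₁ : Tetrahedron t₀₂₃ t₀₂₄ t₀₃₄ t₂₃₄)
    (T₂ : Tetrahedron t₀₁₃ t₀₁₄ t₀₃₄ t₁₃₄) (T₄ : Tetrahedron t₀₁₂ t₀₁₃ t₀₂₃ t₁₂₃) :
    Tetrahedron t₀₁₂ t₀₁₄ t₀₂₄ t₁₂₄ :=
  let H : Horn X 3 3 :=
    { face := fun j _ => ![T₀.simplex, T₁.simplex, T₂.simplex, T₂.simplex, T₄.simplex] j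
      compat := by
        intro j k hj hk hjk
        fin_cases j <;> fin_cases k <;>
          first | exact (hj rfl).elim | exact (hk rfl).elim | exact absurd hjk (by decide) | skip
        · exact T₀.d₀.trans T₁.d₀.symm
        · exact T₀.d₁.trans T₂.d₀.symm
        · exact T₀.d₃.trans T₄.d₀.symm
        · exact T₁.d₁.trans T₂.d₁.symm
        · exact T₁.d₃.trans T₄.d₁.symm
        · exact T₂.d₃.trans T₄.d₂.symm }
  { simplex := X.δ 3 (K.fill H)
    d₃ := (δ_δ_of_lt (K.fill H) (j := 3) (k := 4) (by decide)).trans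
      ((congrArg _ (K.fill_face H 4 (by decide))).trans T₄.d₃)
    d₂ := (δ_δ_of_lt (K.fill H) (j := 2) (k := 3) (by decide)).symm.trans
      ((congrArg _ (K.fill_face H 2 (by decide))).trans T₂.d₂)
    d₁ := (δ_δ_of_lt (K.fill H) (j := 1) (k := 3) (by decide)).symm.trans
      ((congrArg _ (K.fill_face H 1 (by decide))).trans T₁.d₂)
    d₀ := (δ_δ_of_lt (K.fill H) (j := 0) (k := 3) (by decide)).symm.trans
      ((congrArg _ (K.fill_face H 0 (by decide))).trans T₀.d₂) }

/-- The missing face `4` of a `4`-dimensional horn. -/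
def tetrahedron₄ (T₀ : Tetrahedron t₁₂₃ t₁₂₄ t₁₃₄ t₂₃₄) (T₁ : Tetrahedron t₀₂₃ t₀₂₄ t₀₃₄ t₂₃₄)
    (T₂ : Tetrahedron t₀₁₃ t₀₁₄ t₀₃₄ t₁₃₄) (T₃ : Tetrahedron t₀₁₂ t₀₁₄ t₀₂₄ t₁₂₄) :
    Tetrahedron t₀₁₂ t₀₁₃ t₀₂₃ t₁₂₃ :=
  let H : Horn X 3 4 :=
    { face := fun j _ => ![T₀.simplex, T₁.simplex, T₂.simplex, T₃.simplex, T₃.simplex] j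
      compat := by
        intro j k hj hk hjk
        fin_cases j <;> fin_cases k <;>
          first | exact (hj rfl).elim | exact (hk rfl).elim | exact absurd hjk (by decide) | skip
        · exact T₀.d₀.trans T₁.d₀.symm
        · exact T₀.d₁.trans T₂.d₀.symm
        · exact T₀.d₂.trans T₃.d₀.symm
        · exact T₁.d₁.trans T₂.d₁.symm
        · exact T₁.d₂.trans T₃.d₁.symm
        · exact T₂.d₂.trans T₃.d₂.symm }
  { simplex := X.δ 4 (K.fill H)
    d₃ := (δ_δ_of_lt (K.fill H) (j := 3) (k := 4) (by decide)).symm.trans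
      ((congrArg _ (K.fill_face H 3 (by decide))).trans T₃.d₃)
    d₂ := (δ_δ_of_lt (K.fill H) (j := 2) (k := 4) (by decide)).symm.trans
      ((congrArg _ (K.fill_face H 2 (by decide))).trans T₂.d₃)
    d₁ := (δ_δ_of_lt (K.fill H) (j := 1) (k := 4) (by decide)).symm.trans
      ((congrArg _ (K.fill_face H 1 (by decide))).trans T₁.d₃)
    d₀ := (δ_δ_of_lt (K.fill H) (j := 0) (k := 4) (by decide)).symm.trans
      ((congrArg _ (K.fill_face H 0 (by decide))).trans T₀.d₃) }

/-- The chosen filler of a `3`-dimensional horn with missing face `1`. -/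
def fill₁Tetrahedron (t₀₁₂ : SSet.Edge.CompStruct e₀₁ e₁₂ e₀₂)
    (t₀₁₃ : SSet.Edge.CompStruct e₀₁ e₁₃ e₀₃) (t₁₂₃ : SSet.Edge.CompStruct e₁₂ e₂₃ e₁₃) :
    Tetrahedron t₀₁₂ t₀₁₃ (K.fill₁ t₀₁₂ t₀₁₃ t₁₂₃) t₁₂₃ where
  simplex := K.fill (horn₃₁ t₀₁₂ t₀₁₃ t₁₂₃)
  d₃ := K.fill_face (horn₃₁ t₀₁₂ t₀₁₃ t₁₂₃) 3 (by decide)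
  d₂ := K.fill_face (horn₃₁ t₀₁₂ t₀₁₃ t₁₂₃) 2 (by decide)
  d₁ := rfl
  d₀ := K.fill_face (horn₃₁ t₀₁₂ t₀₁₃ t₁₂₃) 0 (by decide)

/-- The chosen filler of a `3`-dimensional horn with missing face `2`. -/
def fill₂Tetrahedron (t₀₁₂ : SSet.Edge.CompStruct e₀₁ e₁₂ e₀₂)
    (t₀₂₃ : SSet.Edge.CompStruct e₀₂ e₂₃ e₀₃) (t₁₂₃ : SSet.Edge.CompStruct e₁₂ e₂₃ e₁₃) :
    Tetrahedron t₀₁₂ (K.fill₂ t₀₁₂ t₀₂₃ t₁₂₃) t₀₂₃ t₁₂₃ where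
  simplex := K.fill (horn₃₂ t₀₁₂ t₀₂₃ t₁₂₃)
  d₃ := K.fill_face (horn₃₂ t₀₁₂ t₀₂₃ t₁₂₃) 3 (by decide)
  d₂ := rfl
  d₁ := K.fill_face (horn₃₂ t₀₁₂ t₀₂₃ t₁₂₃) 1 (by decide)
  d₀ := K.fill_face (horn₃₂ t₀₁₂ t₀₂₃ t₁₂₃) 0 (by decide)

end KanStructure

/-- The degenerate tetrahedron on a triangle which repeats its first vertex. -/
def Tetrahedron.degen₀ (T : SSet.Edge.CompStruct e₀₁ e₁₂ e₀₂) :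
    Tetrahedron (SSet.Edge.CompStruct.idComp e₀₁) (SSet.Edge.CompStruct.idComp e₀₂) T T where
  simplex := X.σ 0 T.simplex
  d₃ := (SSet.δ_comp_σ_of_gt_apply (S := X) (i := 2) (j := 0) (by decide) T.simplex).trans
    (congrArg _ T.d₂)
  d₂ := (SSet.δ_comp_σ_of_gt_apply (S := X) (i := 1) (j := 0) (by decide) T.simplex).trans
    (congrArg _ T.d₁)
  d₁ := SSet.δ_comp_σ_succ_apply (S := X) (i := 0) T.simplex
  d₀ := SSet.δ_comp_σ_self_apply (S := X) (i := 0) T.simplex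

/-- The degenerate tetrahedron on a triangle which repeats its middle vertex. -/
def Tetrahedron.degen₁ (T : SSet.Edge.CompStruct e₀₁ e₁₂ e₀₂) :
    Tetrahedron (SSet.Edge.CompStruct.compId e₀₁) T T (SSet.Edge.CompStruct.idComp e₁₂) where
  simplex := X.σ 1 T.simplex
  d₃ := (SSet.δ_comp_σ_of_gt_apply (S := X) (i := 2) (j := 1) (by decide) T.simplex).trans
    (congrArg _ T.d₂)
  d₂ := SSet.δ_comp_σ_succ_apply (S := X) (i := 1) T.simplex
  d₁ := SSet.δ_comp_σ_self_apply (S := X) (i := 1) T.simplex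
  d₀ := (SSet.δ_comp_σ_of_le_apply (S := X) (i := 0) (j := 0) (by decide) T.simplex).trans
    (congrArg _ T.d₀)

/-- The degenerate tetrahedron on a triangle which repeats its last vertex. -/
def Tetrahedron.degen₂ (T : SSet.Edge.CompStruct e₀₁ e₁₂ e₀₂) :
    Tetrahedron T T (SSet.Edge.CompStruct.compId e₀₂) (SSet.Edge.CompStruct.compId e₁₂) where
  simplex := X.σ 2 T.simplex
  d₃ := SSet.δ_comp_σ_succ_apply (S := X) (i := 2) T.simplex
  d₂ := SSet.δ_comp_σ_self_apply (S := X) (i := 2) T.simplex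
  d₁ := (SSet.δ_comp_σ_of_le_apply (S := X) (i := 1) (j := 1) (by decide) T.simplex).trans
    (congrArg _ T.d₁)
  d₀ := (SSet.δ_comp_σ_of_le_apply (S := X) (i := 0) (j := 1) (by decide) T.simplex).trans
    (congrArg _ T.d₀)

/-- Both are the totally degenerate triangle on `x`. The definition of `Cell₃` uses one form and
homotopy of triangles the other. -/
theorem idCompId_eq_compId (x : Simp X 0) :
    SSet.Edge.CompStruct.idCompId x = SSet.Edge.CompStruct.compId (SSet.Edge.id x) := by
  apply SSet.Edge.CompStruct.ext
  rw [SSet.Edge.CompStruct.idCompId_simplex, SSet.Edge.CompStruct.compId_simplex,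
    SSet.Edge.id_edge]
  exact SSet.σ_comp_σ_apply (S := X) (i := 0) (j := 0) le_rfl x

theorem idComp_id (x : Simp X 0) :
    SSet.Edge.CompStruct.idComp (SSet.Edge.id x) =
      SSet.Edge.CompStruct.compId (SSet.Edge.id x) := by
  rw [← idCompId_eq_compId]
  apply SSet.Edge.CompStruct.ext
  rw [SSet.Edge.CompStruct.idCompId_simplex]
  rfl

end Tetrahedra

end HigherLambda

namespace HigherLambda

open CategoryTheory

/-- Simplicial sets in which every horn has a filler. -/
class IsKan (X : SSet.{u}) : Prop where
  exists_kan : Nonempty (KanStructure X)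

/-- Some choice of horn fillers. -/
noncomputable def someKan (X : SSet.{u}) [IsKan X] : KanStructure X := IsKan.exists_kan.some

/-! ### Homotopy classes of triangles -/

section Homotopy

variable {X : SSet.{u}}

/-- Homotopy of triangles relative to their boundary. -/
def TriHomotopic {x y z : Simp X 0} {f : SSet.Edge x y} {g : SSet.Edge y z} {h : SSet.Edge x z}
    (T T' : SSet.Edge.CompStruct f g h) : Prop :=
  Nonempty (Tetrahedron T T' (SSet.Edge.CompStruct.compId h) (SSet.Edge.CompStruct.compId g))

theorem TriHomotopic.refl {x y z : Simp X 0} {f : SSet.Edge x y} {g : SSet.Edge y z}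
    {h : SSet.Edge x z} (T : SSet.Edge.CompStruct f g h) : TriHomotopic T T :=
  ⟨.degen₂ T⟩

variable [IsKan X] {x₀ x₁ x₂ x₃ : Simp X 0}
  {e₀₁ : SSet.Edge x₀ x₁} {e₀₂ : SSet.Edge x₀ x₂} {e₀₃ : SSet.Edge x₀ x₃}
  {e₁₂ : SSet.Edge x₁ x₂} {e₁₃ : SSet.Edge x₁ x₃} {e₂₃ : SSet.Edge x₂ x₃}
  {a a' : SSet.Edge.CompStruct e₀₁ e₁₂ e₀₂} {b b' : SSet.Edge.CompStruct e₀₁ e₁₃ e₀₃}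
  {c c' : SSet.Edge.CompStruct e₀₂ e₂₃ e₀₃} {d d' : SSet.Edge.CompStruct e₁₂ e₂₃ e₁₃}

namespace Tetrahedron

/-- Two tetrahedra sharing three faces are placed in one 4-dimensional horn with a doubled vertex
and degenerate remaining faces; the missing face is the homotopy. Here vertex `x₂` is doubled and
the horn is outer; in the next two lemmas `x₃` is doubled. -/
theorem homotopic₃ (T : Tetrahedron a b c d) (T' : Tetrahedron a' b c d) : TriHomotopic a a' :=
  ⟨(someKan X).tetrahedron₄ (.degen₁ d) (.degen₁ c) T' T⟩

theorem homotopic₂ (T : Tetrahedron a b c d) (T' : Tetrahedron a b' c d) : TriHomotopic b b' :=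
  ⟨(someKan X).tetrahedron₂ (.degen₂ d) (.degen₂ c) T' T⟩

theorem homotopic₁ (T : Tetrahedron a b c d) (T' : Tetrahedron a b c' d) : TriHomotopic c c' :=
  ⟨(someKan X).tetrahedron₁ (.degen₂ d) (.degen₂ b) T' T⟩

/-- The three faces through `x₃` are replaced together by a 4-simplex that doubles `x₃`, then the
face opposite to it by one that doubles `x₂`. -/
theorem congr (T : Tetrahedron a b c d) (ha : TriHomotopic a a') (hb : TriHomotopic b b')
    (hc : TriHomotopic c c') (hd : TriHomotopic d d') : Nonempty (Tetrahedron a' b' c' d') :=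
  ⟨(someKan X).tetrahedron₂ (.degen₁ d') (.degen₁ c')
    ((someKan X).tetrahedron₃ hd.some hc.some hb.some T) ha.some⟩

end Tetrahedron

theorem TriHomotopic.symm (H : TriHomotopic a a') : TriHomotopic a' a :=
  H.some.homotopic₂ (.degen₂ a)

theorem TriHomotopic.trans {a'' : SSet.Edge.CompStruct e₀₁ e₁₂ e₀₂} (H : TriHomotopic a a')
    (H' : TriHomotopic a' a'') : TriHomotopic a a'' :=
  H.some.congr (.refl _) H' (.refl _) (.refl _)

/-- The setoid of triangles up to homotopy. -/
def triSetoid (f : SSet.Edge x₀ x₁) (g : SSet.Edge x₁ x₂) (h : SSet.Edge x₀ x₂) :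
    Setoid (SSet.Edge.CompStruct f g h) where
  r := TriHomotopic
  iseqv := ⟨.refl, .symm, .trans⟩

/-- Triangles with prescribed edges, up to homotopy. -/
def Tri (f : SSet.Edge x₀ x₁) (g : SSet.Edge x₁ x₂) (h : SSet.Edge x₀ x₂) : Type u :=
  Quotient (triSetoid f g h)

/-- The homotopy class of a triangle. -/
def Tri.mk {f : SSet.Edge x₀ x₁} {g : SSet.Edge x₁ x₂} {h : SSet.Edge x₀ x₂}
    (T : SSet.Edge.CompStruct f g h) : Tri f g h :=
  Quotient.mk (triSetoid f g h) T

/-- A triangle in a given homotopy class. -/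
noncomputable def Tri.out {f : SSet.Edge x₀ x₁} {g : SSet.Edge x₁ x₂} {h : SSet.Edge x₀ x₂}
    (T : Tri f g h) : SSet.Edge.CompStruct f g h :=
  Quotient.out (s := triSetoid f g h) T

theorem Tri.mk_out {f : SSet.Edge x₀ x₁} {g : SSet.Edge x₁ x₂} {h : SSet.Edge x₀ x₂}
    (T : Tri f g h) : Tri.mk T.out = T :=
  Quotient.out_eq (s := triSetoid f g h) T

theorem Tri.mk_eq_mk {f : SSet.Edge x₀ x₁} {g : SSet.Edge x₁ x₂} {h : SSet.Edge x₀ x₂}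
    {T T' : SSet.Edge.CompStruct f g h} : Tri.mk T = Tri.mk T' ↔ TriHomotopic T T' :=
  Quotient.eq (r := triSetoid f g h)

/-- Homotopy classes of triangles which bound a tetrahedron. -/
def Tet (a : Tri e₀₁ e₁₂ e₀₂) (b : Tri e₀₁ e₁₃ e₀₃) (c : Tri e₀₂ e₂₃ e₀₃)
    (d : Tri e₁₂ e₂₃ e₁₃) : Prop :=
  Nonempty (Tetrahedron a.out b.out c.out d.out)

/-- By `congr`, bounding a tetrahedron does not depend on the representatives, so the choice made by
`out` in `Tet` is harmless. -/
theorem Tetrahedron.tet (T : Tetrahedron a b c d) :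
    Tet (Tri.mk a) (Tri.mk b) (Tri.mk c) (Tri.mk d) :=
  T.congr (Tri.mk_eq_mk.1 (Tri.mk_out _).symm) (Tri.mk_eq_mk.1 (Tri.mk_out _).symm)
    (Tri.mk_eq_mk.1 (Tri.mk_out _).symm) (Tri.mk_eq_mk.1 (Tri.mk_out _).symm)

end Homotopy

/-! ### Calculus of tetrahedra on homotopy classes -/

section Tet

variable {X : SSet.{u}} [IsKan X] {x₀ x₁ x₂ x₃ x₄ : Simp X 0}
  {e₀₁ : SSet.Edge x₀ x₁} {e₀₂ : SSet.Edge x₀ x₂} {e₀₃ : SSet.Edge x₀ x₃} {e₀₄ : SSet.Edge x₀ x₄}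
  {e₁₂ : SSet.Edge x₁ x₂} {e₁₃ : SSet.Edge x₁ x₃} {e₁₄ : SSet.Edge x₁ x₄}
  {e₂₃ : SSet.Edge x₂ x₃} {e₂₄ : SSet.Edge x₂ x₄} {e₃₄ : SSet.Edge x₃ x₄}

namespace Tet

section

variable {t₀₁₂ : Tri e₀₁ e₁₂ e₀₂} {t₀₁₃ : Tri e₀₁ e₁₃ e₀₃}
  {t₀₁₄ : Tri e₀₁ e₁₄ e₀₄} {t₀₂₃ : Tri e₀₂ e₂₃ e₀₃}
  {t₀₂₄ : Tri e₀₂ e₂₄ e₀₄} {t₀₃₄ : Tri e₀₃ e₃₄ e₀₄}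
  {t₁₂₃ : Tri e₁₂ e₂₃ e₁₃} {t₁₂₄ : Tri e₁₂ e₂₄ e₁₄}
  {t₁₃₄ : Tri e₁₃ e₃₄ e₁₄} {t₂₃₄ : Tri e₂₃ e₃₄ e₂₄}

theorem face₁ (T₀ : Tet t₁₂₃ t₁₂₄ t₁₃₄ t₂₃₄) (T₂ : Tet t₀₁₃ t₀₁₄ t₀₃₄ t₁₃₄)
    (T₃ : Tet t₀₁₂ t₀₁₄ t₀₂₄ t₁₂₄) (T₄ : Tet t₀₁₂ t₀₁₃ t₀₂₃ t₁₂₃) :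
    Tet t₀₂₃ t₀₂₄ t₀₃₄ t₂₃₄ :=
  ⟨(someKan X).tetrahedron₁ T₀.some T₂.some T₃.some T₄.some⟩

theorem face₂ (T₀ : Tet t₁₂₃ t₁₂₄ t₁₃₄ t₂₃₄) (T₁ : Tet t₀₂₃ t₀₂₄ t₀₃₄ t₂₃₄)
    (T₃ : Tet t₀₁₂ t₀₁₄ t₀₂₄ t₁₂₄) (T₄ : Tet t₀₁₂ t₀₁₃ t₀₂₃ t₁₂₃) :
    Tet t₀₁₃ t₀₁₄ t₀₃₄ t₁₃₄ :=
  ⟨(someKan X).tetrahedron₂ T₀.some T₁.some T₃.some T₄.some⟩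

theorem face₃ (T₀ : Tet t₁₂₃ t₁₂₄ t₁₃₄ t₂₃₄) (T₁ : Tet t₀₂₃ t₀₂₄ t₀₃₄ t₂₃₄)
    (T₂ : Tet t₀₁₃ t₀₁₄ t₀₃₄ t₁₃₄) (T₄ : Tet t₀₁₂ t₀₁₃ t₀₂₃ t₁₂₃) :
    Tet t₀₁₂ t₀₁₄ t₀₂₄ t₁₂₄ :=
  ⟨(someKan X).tetrahedron₃ T₀.some T₁.some T₂.some T₄.some⟩

end

variable {a a' : Tri e₀₁ e₁₂ e₀₂} {b b' : Tri e₀₁ e₁₃ e₀₃} {c c' : Tri e₀₂ e₂₃ e₀₃}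
  {d d' : Tri e₁₂ e₂₃ e₁₃}

theorem unique₃ (T : Tet a b c d) (T' : Tet a' b c d) : a = a' := by
  rw [← a.mk_out, ← a'.mk_out]
  exact Tri.mk_eq_mk.2 (T.some.homotopic₃ T'.some)

theorem unique₂ (T : Tet a b c d) (T' : Tet a b' c d) : b = b' := by
  rw [← b.mk_out, ← b'.mk_out]
  exact Tri.mk_eq_mk.2 (T.some.homotopic₂ T'.some)

theorem unique₁ (T : Tet a b c d) (T' : Tet a b c' d) : c = c' := by
  rw [← c.mk_out, ← c'.mk_out]
  exact Tri.mk_eq_mk.2 (T.some.homotopic₁ T'.some)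

theorem exists₂ (a : Tri e₀₁ e₁₂ e₀₂) (c : Tri e₀₂ e₂₃ e₀₃) (d : Tri e₁₂ e₂₃ e₁₃) :
    ∃ b, Tet a b c d := by
  have T := ((someKan X).fill₂Tetrahedron a.out c.out d.out).tet
  simp only [Tri.mk_out] at T
  exact ⟨_, T⟩

theorem exists₁ (a : Tri e₀₁ e₁₂ e₀₂) (b : Tri e₀₁ e₁₃ e₀₃) (d : Tri e₁₂ e₂₃ e₁₃) :
    ∃ c, Tet a b c d := by
  have T := ((someKan X).fill₁Tetrahedron a.out b.out d.out).tet
  simp only [Tri.mk_out] at T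
  exact ⟨_, T⟩

end Tet

namespace Tri

/-- The class of the degenerate triangle repeating the last vertex of an edge. -/
def compId (f : SSet.Edge x₀ x₁) : Tri f (SSet.Edge.id x₁) f :=
  .mk (SSet.Edge.CompStruct.compId f)

/-- The class of the degenerate triangle repeating the first vertex of an edge. -/
def idComp (f : SSet.Edge x₀ x₁) : Tri (SSet.Edge.id x₀) f f :=
  .mk (SSet.Edge.CompStruct.idComp f)

theorem mk_idCompId (x : Simp X 0) :
    mk (SSet.Edge.CompStruct.idCompId x) = compId (SSet.Edge.id x) :=
  congrArg mk (idCompId_eq_compId x)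

theorem idComp_id (x : Simp X 0) : idComp (SSet.Edge.id x) = compId (SSet.Edge.id x) :=
  congrArg mk (HigherLambda.idComp_id x)

end Tri

namespace Tet

theorem degen₀ (T : Tri e₀₁ e₁₂ e₀₂) : Tet (.idComp e₀₁) (.idComp e₀₂) T T := by
  have h := (Tetrahedron.degen₀ T.out).tet
  rwa [T.mk_out] at h

theorem degen₁ (T : Tri e₀₁ e₁₂ e₀₂) : Tet (.compId e₀₁) T T (.idComp e₁₂) := by
  have h := (Tetrahedron.degen₁ T.out).tet
  rwa [T.mk_out] at h

theorem degen₂ (T : Tri e₀₁ e₁₂ e₀₂) : Tet T T (.compId e₀₂) (.compId e₁₂) := by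
  have h := (Tetrahedron.degen₂ T.out).tet
  rwa [T.mk_out] at h

end Tet

/-! ### The three actions of `2`-cells on triangles -/

variable {x y z : Simp X 0} {f f' f'' : SSet.Edge x y} {g g' g'' : SSet.Edge y z}
  {h h' h'' : SSet.Edge x z}

namespace Tri

/-- Move the long edge of a triangle along a `2`-cell. -/
noncomputable def push (T : Tri f g h) (α : Tri h (SSet.Edge.id z) h') : Tri f g h' :=
  (Tet.exists₂ T α (compId g)).choose

theorem tet_push (T : Tri f g h) (α : Tri h (SSet.Edge.id z) h') :
    Tet T (T.push α) α (compId g) :=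
  (Tet.exists₂ T α (compId g)).choose_spec

/-- Move the first edge of a triangle backwards along a `2`-cell. -/
noncomputable def pull (η : Tri f (SSet.Edge.id y) f') (T : Tri f' g h) : Tri f g h :=
  (Tet.exists₂ η T (idComp g)).choose

theorem tet_pull (η : Tri f (SSet.Edge.id y) f') (T : Tri f' g h) :
    Tet η (pull η T) T (idComp g) :=
  (Tet.exists₂ η T (idComp g)).choose_spec

/-- Move the second edge of a triangle along a `2`-cell. -/
noncomputable def slide (T : Tri f g h) (θ : Tri g (SSet.Edge.id z) g') : Tri f g' h :=
  (Tet.exists₂ T (compId h) θ).choose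

theorem tet_slide (T : Tri f g h) (θ : Tri g (SSet.Edge.id z) g') :
    Tet T (T.slide θ) (compId h) θ :=
  (Tet.exists₂ T (compId h) θ).choose_spec

theorem push_compId (T : Tri f g h) : T.push (compId h) = T :=
  (T.tet_push _).unique₂ (.degen₂ T)

theorem compId_push (α : Tri f (SSet.Edge.id y) f') : (compId f).push α = α :=
  ((compId f).tet_push α).unique₂ (by rw [← idComp_id]; exact .degen₁ α)

/-- The pattern for all the action laws: the 4-simplex whose faces are the defining tetrahedra and a
degenerate one yields a tetrahedron that also defines the other side. -/
theorem push_push (T : Tri f g h) (α : Tri h (SSet.Edge.id z) h')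
    (β : Tri h' (SSet.Edge.id z) h'') : (T.push α).push β = T.push (α.push β) :=
  (Tet.face₃ (.degen₂ _) (α.tet_push β) ((T.push α).tet_push β) (T.tet_push α)).unique₂
    (T.tet_push _)

/-- Freeness of the action on long edges; together with transitivity (`exists_push_eq`) it reduces
equations between 2-cells to equations between triangles. -/
theorem push_injective (T : Tri f g h) {α α' : Tri h (SSet.Edge.id z) h'}
    (H : T.push α = T.push α') : α = α' :=
  (T.tet_push α).unique₁ (H ▸ T.tet_push α')

theorem exists_push_eq (T : Tri f g h) (T' : Tri f g h') : ∃ α, T.push α = T' := by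
  obtain ⟨α, H⟩ := Tet.exists₁ T T' (compId g)
  exact ⟨α, (T.tet_push α).unique₂ H⟩

theorem pull_compId (T : Tri f g h) : pull (compId f) T = T :=
  (tet_pull _ T).unique₂ (.degen₁ T)

theorem pull_pull (η : Tri f (SSet.Edge.id y) f') (η' : Tri f' (SSet.Edge.id y) f'')
    (T : Tri f'' g h) : pull η (pull η' T) = pull (η.push η') T :=
  (Tet.face₂ (by rw [← idComp_id]; exact .degen₀ _) (tet_pull η' T) (tet_pull η (pull η' T))
    (η.tet_push η')).unique₂ (tet_pull _ T)

theorem slide_slide (T : Tri f g h) (θ : Tri g (SSet.Edge.id z) g')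
    (θ' : Tri g' (SSet.Edge.id z) g'') : (T.slide θ).slide θ' = T.slide (θ.push θ') :=
  (Tet.face₃ (θ.tet_push θ') (.degen₂ _) ((T.slide θ).tet_slide θ') (T.tet_slide θ)).unique₂
    (T.tet_slide _)

theorem slide_injective {T T' : Tri f g h} (θ : Tri g (SSet.Edge.id z) g')
    (H : T.slide θ = T'.slide θ) : T = T' :=
  (T.tet_slide θ).unique₃ (H ▸ T'.tet_slide θ)

theorem pull_push (η : Tri f (SSet.Edge.id y) f') (T : Tri f' g h)
    (α : Tri h (SSet.Edge.id z) h') : pull η (T.push α) = (pull η T).push α :=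
  (Tet.face₂ (.degen₂ _) (T.tet_push α) (tet_pull η (T.push α)) (tet_pull η T)).unique₂
    ((pull η T).tet_push α)

theorem pull_slide (η : Tri f (SSet.Edge.id y) f') (T : Tri f' g h)
    (θ : Tri g (SSet.Edge.id z) g') : pull η (T.slide θ) = (pull η T).slide θ :=
  (Tet.face₂ (.degen₀ θ) (T.tet_slide θ) (tet_pull η (T.slide θ)) (tet_pull η T)).unique₂
    ((pull η T).tet_slide θ)

/-- A tetrahedron whose last edge is degenerate factors into a push of the long edge and a slide of
the second edge. By uniqueness, each such tetrahedron is thereby an equation between actions. -/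
theorem tet_push_slide (T : Tri f g h) (α : Tri h (SSet.Edge.id z) h')
    (θ : Tri g (SSet.Edge.id z) g') : Tet T ((T.push α).slide θ) α θ :=
  .face₃ (by rw [← idComp_id]; exact .degen₁ θ) (.degen₂ α) ((T.push α).tet_slide θ)
    (T.tet_push α)

theorem slide_push (T : Tri f g h) (α : Tri h (SSet.Edge.id z) h')
    (θ : Tri g (SSet.Edge.id z) g') : (T.slide θ).push α = (T.push α).slide θ :=
  (Tet.face₃ (.degen₂ θ) (by rw [← idComp_id]; exact .degen₁ α) ((T.slide θ).tet_push α)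
    (T.tet_slide θ)).unique₂ (T.tet_push_slide α θ)

theorem push_slide_idComp (θ : Tri f (SSet.Edge.id y) f') :
    ((idComp f).push θ).slide θ = idComp f' :=
  ((idComp f).tet_push_slide θ θ).unique₂ (.degen₀ θ)

end Tri

namespace Tet

variable {a : Tri e₀₁ e₁₂ e₀₂} {b : Tri e₀₁ e₁₃ e₀₃} {c : Tri e₀₂ e₂₃ e₀₃}
  {d : Tri e₁₂ e₂₃ e₁₃}

/-- Here and in the lemmas below, moving one edge of a tetrahedron along a 2-cell alters exactly the
two triangles containing that edge. -/
theorem push₀₃ {e₀₃' : SSet.Edge x₀ x₃} (T : Tet a b c d)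
    (α : Tri e₀₃ (SSet.Edge.id x₃) e₀₃') : Tet a (b.push α) (c.push α) d :=
  .face₃ (.degen₂ d) (c.tet_push α) (b.tet_push α) T

theorem pull₀₁ {e₀₁' : SSet.Edge x₀ x₁} (η : Tri e₀₁' (SSet.Edge.id x₁) e₀₁)
    (T : Tet a b c d) : Tet (Tri.pull η a) (Tri.pull η b) c d :=
  .face₂ (.degen₀ d) T (Tri.tet_pull η b) (Tri.tet_pull η a)

/-- A push on one triangle through the edge `02` can be traded for a pull on the other, since `02`
is the long edge of the first and the initial edge of the second. -/
theorem move₀₂ {e₀₂' : SSet.Edge x₀ x₂} {α : Tri e₀₂ (SSet.Edge.id x₂) e₀₂'}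
    {c : Tri e₀₂' e₂₃ e₀₃} (T : Tet (a.push α) b c d) : Tet a b (Tri.pull α c) d :=
  .face₃ (.degen₁ d) (Tri.tet_pull α c) T (a.tet_push α)

theorem move₁₂ {e₁₂' : SSet.Edge x₁ x₂} {θ : Tri e₁₂ (SSet.Edge.id x₂) e₁₂'}
    {d : Tri e₁₂' e₂₃ e₁₃} (T : Tet (a.slide θ) b c d) : Tet a b c (Tri.pull θ d) :=
  .face₃ (Tri.tet_pull θ d) (.degen₁ c) T (a.tet_slide θ)

theorem push₁₃ {e₁₃' : SSet.Edge x₁ x₃} (T : Tet a b c d)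
    (θ : Tri e₁₃ (SSet.Edge.id x₃) e₁₃') : Tet a (b.slide θ) c (d.push θ) :=
  .face₃ (d.tet_push θ) (.degen₂ c) (b.tet_slide θ) T

theorem slide₂₃ {e₂₃' : SSet.Edge x₂ x₃} (T : Tet a b c d)
    (θ : Tri e₂₃ (SSet.Edge.id x₃) e₂₃') : Tet a b (c.slide θ) (d.slide θ) :=
  .face₃ (d.tet_slide θ) (c.tet_slide θ) (.degen₂ b) T

end Tet

end Tet

/-! ### Edges as objects of a groupoid -/

section Category

variable {X : SSet.{u}} [IsKan X] {x y z w v : Simp X 0}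

noncomputable instance : Category (SSet.Edge x y) where
  Hom f g := Tri f (SSet.Edge.id y) g
  id f := .compId f
  comp α β := Tri.push α β
  id_comp := Tri.compId_push
  comp_id := Tri.push_compId
  assoc := Tri.push_push

namespace Tri

variable {f f' f'' : SSet.Edge x y} {g g' g'' : SSet.Edge y z} {h h' h'' : SSet.Edge x z}

theorem push_id (T : Tri f g h) : T.push (𝟙 h) = T := T.push_compId

theorem push_comp (T : Tri f g h) (α : h ⟶ h') (β : h' ⟶ h'') :
    T.push (α ≫ β) = (T.push α).push β := (T.push_push α β).symm

theorem pull_id (T : Tri f g h) : pull (𝟙 f) T = T := T.pull_compId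

theorem pull_comp (η : f ⟶ f') (η' : f' ⟶ f'') (T : Tri f'' g h) :
    pull (η ≫ η') T = pull η (pull η' T) := (pull_pull η η' T).symm

theorem slide_comp (T : Tri f g h) (θ : g ⟶ g') (θ' : g' ⟶ g'') :
    T.slide (θ ≫ θ') = (T.slide θ).slide θ' := (T.slide_slide θ θ').symm

end Tri

instance {f g : SSet.Edge x y} (α : f ⟶ g) : IsIso α := by
  have key : ∀ {f g : SSet.Edge x y} (α : f ⟶ g), ∃ β : g ⟶ f, α ≫ β = 𝟙 f := fun α =>
    Tri.exists_push_eq α _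
  obtain ⟨β, hβ⟩ := key α
  obtain ⟨γ, hγ⟩ := key β
  -- Every morphism has a right inverse by transitivity; a right inverse `γ` of the right inverse
  -- `β` must be `α`, so `β` is two-sided.
  have : α = γ := by
    rw [← Category.comp_id α, ← hγ, ← Category.assoc, hβ, Category.id_comp]
  exact ⟨β, hβ, this ▸ hγ⟩

/-- The class of a `2`-cell as a morphism. -/
def cls {f g : SSet.Edge x y} (α : Cell₂ f g) : f ⟶ g := Tri.mk α

/-- The dictionary through which the existence of 3-cells is turned into equations in the groupoid
of edges. -/
theorem nonempty_cell₃_iff {f g : SSet.Edge x y} {α β : Cell₂ f g} :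
    Nonempty (Cell₃ α β) ↔ cls α = cls β := by
  refine Iff.trans ?_ Tri.mk_eq_mk.symm
  unfold TriHomotopic Cell₃
  rw [idCompId_eq_compId]

theorem cls_ofEq {f g : SSet.Edge x y} (h : f = g) : cls (Cell₂.ofEq h) = eqToHom h := by
  subst h
  rfl

end Category

/-! ### The bicategorical structure given by the chosen fillers

Up to `3`-cells, the laws hold for every choice of horn fillers. -/

namespace KanStructure

variable {X : SSet.{u}} [IsKan X] (K : KanStructure X) {x y z w v : Simp X 0}

/-- The chosen filler and the abstract operation solve the same three-face problem, so uniqueness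
identifies their classes. The same argument gives `cls_inv`, `cls_wl` and `cls_wr`. -/
theorem cls_vcomp {f g h : SSet.Edge x y} (α : Cell₂ f g) (β : Cell₂ g h) :
    cls (K.vcomp α β) = cls α ≫ cls β := by
  have T := (K.fill₂Tetrahedron α β (SSet.Edge.CompStruct.idCompId y)).tet
  rw [Tri.mk_idCompId] at T
  exact T.unique₂ (Tri.tet_push _ _)

theorem cls_inv {f g : SSet.Edge x y} (α : Cell₂ f g) : cls (K.inv α) = CategoryTheory.inv (cls α) := by
  have T := (K.fill₁Tetrahedron α (Cell₂.refl f) (SSet.Edge.CompStruct.idCompId y)).tet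
  rw [Tri.mk_idCompId] at T
  exact IsIso.eq_inv_of_hom_inv_id ((Tri.tet_push _ _).unique₂ T)

/-- The class of the composition triangle. -/
def tri (f : SSet.Edge x y) (g : SSet.Edge y z) : Tri f g (K.comp f g) := .mk (K.compTri f g)

theorem push_cls_compare {f : SSet.Edge x y} {g : SSet.Edge y z} {h h' : SSet.Edge x z}
    (T : SSet.Edge.CompStruct f g h) (T' : SSet.Edge.CompStruct f g h') :
    (Tri.mk T).push (cls (K.compare T T')) = Tri.mk T' :=
  (Tri.tet_push _ _).unique₂ (K.fill₁Tetrahedron T T' (Cell₂.refl g)).tet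

/-- Left whiskering of classes of `2`-cells. -/
noncomputable def whiskerL (f : SSet.Edge x y) {g g' : SSet.Edge y z} (θ : g ⟶ g') :
    K.comp f g ⟶ K.comp f g' :=
  (Tet.exists₁ (K.tri f g) (K.tri f g') θ).choose

theorem tet_whiskerL (f : SSet.Edge x y) {g g' : SSet.Edge y z} (θ : g ⟶ g') :
    Tet (K.tri f g) (K.tri f g') (K.whiskerL f θ) θ :=
  (Tet.exists₁ (K.tri f g) (K.tri f g') θ).choose_spec

/-- Right whiskering of classes of `2`-cells. -/
noncomputable def whiskerR {f f' : SSet.Edge x y} (η : f ⟶ f') (g : SSet.Edge y z) :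
    K.comp f g ⟶ K.comp f' g :=
  ((K.tri f g).exists_push_eq (Tri.pull η (K.tri f' g))).choose

theorem push_whiskerR {f f' : SSet.Edge x y} (η : f ⟶ f') (g : SSet.Edge y z) :
    (K.tri f g).push (K.whiskerR η g) = Tri.pull η (K.tri f' g) :=
  ((K.tri f g).exists_push_eq (Tri.pull η (K.tri f' g))).choose_spec

/-- With `push_whiskerR`, this describes whiskering purely by actions on composition triangles; the
laws below use these descriptions instead of fillers. -/
theorem slide_push_whiskerL (f : SSet.Edge x y) {g g' : SSet.Edge y z} (θ : g ⟶ g') :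
    ((K.tri f g).push (K.whiskerL f θ)).slide θ = K.tri f g' :=
  ((K.tri f g).tet_push_slide _ θ).unique₂ (K.tet_whiskerL f θ)

theorem cls_wl (f : SSet.Edge x y) {g g' : SSet.Edge y z} (θ : Cell₂ g g') :
    cls (K.wl f θ) = K.whiskerL f (cls θ) :=
  (K.fill₁Tetrahedron (K.compTri f g) (K.compTri f g') θ).tet.unique₁ (K.tet_whiskerL f _)

theorem cls_wr {f f' : SSet.Edge x y} (η : Cell₂ f f') (g : SSet.Edge y z) :
    cls (K.wr η g) = K.whiskerR (cls η) g := by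
  apply (K.tri f g).push_injective
  rw [push_whiskerR]
  exact (K.push_cls_compare _ _).trans
    ((K.fill₂Tetrahedron η (K.compTri f' g) (SSet.Edge.CompStruct.idComp g)).tet.unique₂
      (Tri.tet_pull _ _))

/-- The class of the associator. -/
def assoc (f : SSet.Edge x y) (g : SSet.Edge y z) (h : SSet.Edge z w) :
    K.comp (K.comp f g) h ⟶ K.comp f (K.comp g h) := cls (K.ass f g h)

/-- The class of the left unitor. -/
def leftUnit (f : SSet.Edge x y) : K.comp (SSet.Edge.id x) f ⟶ f := cls (K.lunit f)

/-- The characterisation of the associator: it is the correction of the long edge of the triangle on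
`f·g, h` that lets four composition triangles bound a tetrahedron. -/
theorem tet_assoc (f : SSet.Edge x y) (g : SSet.Edge y z) (h : SSet.Edge z w) :
    Tet (K.tri f g) (K.tri f (K.comp g h)) ((K.tri (K.comp f g) h).push (K.assoc f g h))
      (K.tri g h) := by
  have T := (K.fill₂Tetrahedron (K.compTri f g) (K.compTri (K.comp f g) h) (K.compTri g h)).tet
  have T' := T.push₀₃ (K.assoc f g h)
  have e : (Tri.mk (K.fill₂ (K.compTri f g) (K.compTri (K.comp f g) h) (K.compTri g h))).push
      (K.assoc f g h) = _ := K.push_cls_compare _ _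
  rw [e] at T'
  exact T'

theorem push_leftUnit (f : SSet.Edge x y) :
    (K.tri (SSet.Edge.id x) f).push (K.leftUnit f) = Tri.idComp f :=
  K.push_cls_compare _ _

section Laws

variable {f f' f'' : SSet.Edge x y} {g g' g'' : SSet.Edge y z} {h h' : SSet.Edge z w}

@[simp]
theorem whiskerL_id (f : SSet.Edge x y) (g : SSet.Edge y z) : K.whiskerL f (𝟙 g) = 𝟙 _ :=
  (K.tet_whiskerL f (𝟙 g)).unique₁ (.degen₂ _)

@[simp]
theorem whiskerL_comp (f : SSet.Edge x y) (θ : g ⟶ g') (θ' : g' ⟶ g'') :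
    K.whiskerL f (θ ≫ θ') = K.whiskerL f θ ≫ K.whiskerL f θ' := by
  apply (K.tri f g).push_injective
  apply Tri.slide_injective (θ ≫ θ')
  rw [slide_push_whiskerL, Tri.slide_comp, Tri.push_comp, ← Tri.slide_push,
    slide_push_whiskerL, slide_push_whiskerL]

@[simp]
theorem whiskerR_id (f : SSet.Edge x y) (g : SSet.Edge y z) : K.whiskerR (𝟙 f) g = 𝟙 _ := by
  apply (K.tri f g).push_injective
  rw [push_whiskerR, Tri.pull_id, Tri.push_id]

@[simp]
theorem whiskerR_comp (η : f ⟶ f') (η' : f' ⟶ f'') (g : SSet.Edge y z) :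
    K.whiskerR (η ≫ η') g = K.whiskerR η g ≫ K.whiskerR η' g := by
  apply (K.tri f g).push_injective
  rw [push_whiskerR, Tri.pull_comp, Tri.push_comp, push_whiskerR, ← Tri.pull_push, push_whiskerR]

/-- Pulling the first edge commutes with pushing the long edge and with sliding the second edge. -/
theorem whisker_exchange (η : f ⟶ f') (θ : g ⟶ g') :
    K.whiskerR η g ≫ K.whiskerL f' θ = K.whiskerL f θ ≫ K.whiskerR η g' := by
  apply (K.tri f g).push_injective
  apply Tri.slide_injective θ
  rw [Tri.push_comp, push_whiskerR, ← Tri.pull_push, ← Tri.pull_slide, slide_push_whiskerL,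
    Tri.push_comp, ← Tri.slide_push, slide_push_whiskerL, push_whiskerR]

/-- The associator tetrahedron of the new edges, moved back along `η`, and that of the old edges,
pushed forward, share three faces; the fourth is the equation. The other two naturality laws follow
the same scheme. -/
theorem assoc_naturality_left (η : f ⟶ f') (g : SSet.Edge y z) (h : SSet.Edge z w) :
    K.whiskerR (K.whiskerR η g) h ≫ K.assoc f' g h =
      K.assoc f g h ≫ K.whiskerR η (K.comp g h) := by
  apply (K.tri (K.comp f g) h).push_injective
  have T := (K.tet_assoc f' g h).pull₀₁ η
  rw [← push_whiskerR, ← push_whiskerR] at T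
  have T := T.move₀₂
  have T' := (K.tet_assoc f g h).push₀₃ (K.whiskerR η (K.comp g h))
  rw [Tri.push_comp, push_whiskerR, ← Tri.pull_push, Tri.push_comp]
  exact T.unique₁ T'

theorem assoc_naturality_middle (f : SSet.Edge x y) (η : g ⟶ g') (h : SSet.Edge z w) :
    K.whiskerR (K.whiskerL f η) h ≫ K.assoc f g' h =
      K.assoc f g h ≫ K.whiskerL f (K.whiskerR η h) := by
  apply (K.tri (K.comp f g) h).push_injective
  have T := K.tet_assoc f g' h
  -- The triangle on `f, g'` becomes the triangle on `f, g`, pushed and slid, so that both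
  -- modifications can be transferred to the neighbouring faces.
  rw [← K.slide_push_whiskerL f η] at T
  have T := T.move₁₂.move₀₂
  have T' := ((K.tet_assoc f g h).push₀₃ (K.whiskerL f (K.whiskerR η h))).push₁₃
    (K.whiskerR η h)
  rw [slide_push_whiskerL, push_whiskerR] at T'
  rw [Tri.push_comp, push_whiskerR, ← Tri.pull_push, Tri.push_comp]
  exact T.unique₁ T'

theorem assoc_naturality_right (f : SSet.Edge x y) (g : SSet.Edge y z) (η : h ⟶ h') :
    K.whiskerL (K.comp f g) η ≫ K.assoc f g h' =
      K.assoc f g h ≫ K.whiskerL f (K.whiskerL g η) := by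
  apply (K.tri (K.comp f g) h).push_injective
  apply Tri.slide_injective η
  have T' := (((K.tet_assoc f g h).push₀₃ (K.whiskerL f (K.whiskerL g η))).push₁₃
    (K.whiskerL g η)).slide₂₃ η
  rw [slide_push_whiskerL, slide_push_whiskerL] at T'
  rw [Tri.push_comp, ← Tri.slide_push, slide_push_whiskerL, Tri.push_comp]
  exact (K.tet_assoc f g h').unique₁ T'

/-- In the 4-simplex on `f, g, h, k`, the associator tetrahedra opposite vertices 0, 2, 3, 4 fit
together once the one opposite 2 is adjusted by the whiskered associator of `g, h, k`. The resulting
face opposite 1 is compared with the associator tetrahedron of `f·g, h, k`. -/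
theorem pentagon (f : SSet.Edge x y) (g : SSet.Edge y z) (h : SSet.Edge z w)
    (k : SSet.Edge w v) :
    K.assoc (K.comp f g) h k ≫ K.assoc f g (K.comp h k) =
      K.whiskerR (K.assoc f g h) k ≫ K.assoc f (K.comp g h) k ≫
        K.whiskerL f (K.assoc g h k) := by
  apply (K.tri (K.comp (K.comp f g) h) k).push_injective
  have T₂ := ((K.tet_assoc f (K.comp g h) k).push₀₃ (K.whiskerL f (K.assoc g h k))).push₁₃
    (K.assoc g h k)
  rw [slide_push_whiskerL] at T₂
  have T₁ := (Tet.face₁ (K.tet_assoc g h k) T₂ (K.tet_assoc f g (K.comp h k))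
    (K.tet_assoc f g h)).move₀₂
  have T₁' := (K.tet_assoc (K.comp f g) h k).push₀₃ (K.assoc f g (K.comp h k))
  rw [Tri.push_comp, Tri.push_comp, push_whiskerR, Tri.push_comp, ← Tri.pull_push,
    ← Tri.pull_push]
  exact T₁'.unique₁ T₁

theorem leftUnit_naturality (θ : f ⟶ f') :
    K.whiskerL (SSet.Edge.id x) θ ≫ K.leftUnit f' = K.leftUnit f ≫ θ := by
  apply (K.tri (SSet.Edge.id x) f).push_injective
  apply Tri.slide_injective θ
  rw [Tri.push_comp, ← Tri.slide_push, slide_push_whiskerL, push_leftUnit, Tri.push_comp,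
    push_leftUnit, Tri.push_slide_idComp]

/-- The degenerate tetrahedron on the composition triangle of `f, g` is an associator tetrahedron
corrected by left unitors. -/
theorem leftUnit_comp (f : SSet.Edge x y) (g : SSet.Edge y z) :
    K.assoc (SSet.Edge.id x) f g ≫ K.leftUnit (K.comp f g) = K.whiskerR (K.leftUnit f) g := by
  apply (K.tri (K.comp (SSet.Edge.id x) f) g).push_injective
  have T := Tet.degen₀ (K.tri f g)
  rw [← K.push_leftUnit f, ← K.push_leftUnit (K.comp f g)] at T
  rw [Tri.push_comp, push_whiskerR]
  exact ((K.tet_assoc (SSet.Edge.id x) f g).push₀₃ (K.leftUnit (K.comp f g))).unique₁ T.move₀₂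

theorem whiskerL_eqToHom (f : SSet.Edge x y) (H : g = g') :
    K.whiskerL f (eqToHom H) = eqToHom (by rw [H]) := by
  subst H
  simp

end Laws

end KanStructure

end HigherLambda

namespace HigherLambda

open CategoryTheory

/-! ### Chains of rebracketings -/

namespace RebracketChain

variable {M N P : Term}

/-- Concatenation of chains. -/
def trans {t t' t'' : Paren M N} : RebracketChain t t' → RebracketChain t' t'' →
    RebracketChain t t''
  | .nil _, c' => c'
  | .cons m c, c' => .cons m (c.trans c')

/-- The chain of a single rebracketing. -/
def single {t t' : Paren M N} (m : Rebracket t t') : RebracketChain t t' := .cons m (.nil _)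

/-- Rebracketing the left factor. -/
def left {a a' : Paren M N} (b : Paren N P) :
    RebracketChain a a' → RebracketChain (.node a b) (.node a' b)
  | .nil _ => .nil _
  | .cons m c => .cons (.left m b) (c.left b)

/-- Rebracketing the right factor. -/
def right (a : Paren M N) {b b' : Paren N P} :
    RebracketChain b b' → RebracketChain (.node a b) (.node a b')
  | .nil _ => .nil _
  | .cons m c => .cons (.right a m) (c.right a)

end RebracketChain

/-- The inverse of an elementary rebracketing. -/
def Rebracket.symm : {M N : Term} → {t t' : Paren M N} → Rebracket t t' → Rebracket t' t
  | _, _, _, _, .assoc a b c => .assocInv a b c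
  | _, _, _, _, .assocInv a b c => .assoc a b c
  | _, _, _, _, .left m b => .left m.symm b
  | _, _, _, _, .right a m => .right a m.symm

/-- The inverse of a chain. -/
def RebracketChain.symm {M N : Term} {t t' : Paren M N} :
    RebracketChain t t' → RebracketChain t' t
  | .nil _ => .nil _
  | .cons m c => c.symm.trans (.single m.symm)

/-- The parenthesization of a list of factors to the right. -/
def Factors.comb : {M N : Term} → Factors M N → Paren M N
  | _, _, .one p => .leaf p
  | _, _, .cons p l => .node (.leaf p) l.comb

/-- Reassociating the composite of two right combs to a right comb. -/
def RebracketChain.combAppend : {M N P : Term} → (l : Factors M N) → (k : Factors N P) →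
    RebracketChain (.node l.comb k.comb) (l.append k).comb
  | _, _, _, .one _, _ => .nil _
  | _, _, _, .cons _ l, k => .cons (.assoc _ _ _) ((combAppend l k).right _)

/-- Reassociating a parenthesized composite to a right comb. -/
def RebracketChain.toComb : {M N : Term} → (t : Paren M N) → RebracketChain t t.factors.comb
  | _, _, .leaf _ => .nil _
  | _, _, .node a b =>
      ((toComb a).left b).trans (((toComb b).right _).trans (combAppend a.factors b.factors))

/-- Both sides reassociate to the right comb of the common list of factors, and chains are
invertible. -/
theorem RebracketChain.nonempty_of_factors_eq {M N : Term} {t t' : Paren M N}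
    (h : t.factors = t'.factors) : Nonempty (RebracketChain t t') := by
  have c' := (toComb t').symm
  rw [← h] at c'
  exact ⟨(toComb t).trans c'⟩

/-! ### Classes of the concatenation comparisons -/

namespace ExtensionalKanComplex

instance (K : ExtensionalKanComplex.{u}) : IsKan K.X := ⟨⟨K.kan⟩⟩

variable (K : ExtensionalKanComplex.{u}) (ρ : K.Env) {M N P Q R : Term}

theorem cls_eqCell {p q : RedSeq M N} (h : p = q) :
    cls (K.eqCell ρ h) = eqToHom (congrArg (K.seq ρ) h) :=
  cls_ofEq _

/-- The class of the comparison `⟦p⟧·⟦q⟧ ⇒ ⟦p·q⟧`. -/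
noncomputable def concatHom (p : RedSeq M N) (q : RedSeq N P) :
    K.kan.comp (K.seq ρ p) (K.seq ρ q) ⟶ K.seq ρ (p.concat q) :=
  cls (K.concatCell ρ p q)

theorem concatHom_step (s : BetaEtaStep M N) (p : RedSeq N P) (q : RedSeq P Q) :
    K.concatHom ρ (.step s p) q =
      K.kan.assoc (K.stepEdge ρ s) (K.seq ρ p) (K.seq ρ q) ≫
        K.kan.whiskerL (K.stepEdge ρ s) (K.concatHom ρ p q) :=
  (K.kan.cls_vcomp _ _).trans (congrArg _ (K.kan.cls_wl _ _))

theorem concatHom_stepInv (s : BetaEtaStep N M) (p : RedSeq N P) (q : RedSeq P Q) :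
    K.concatHom ρ (.stepInv s p) q =
      K.kan.assoc (K.kan.symm (K.stepEdge ρ s)) (K.seq ρ p) (K.seq ρ q) ≫
        K.kan.whiskerL (K.kan.symm (K.stepEdge ρ s)) (K.concatHom ρ p q) :=
  (K.kan.cls_vcomp _ _).trans (congrArg _ (K.kan.cls_wl _ _))

theorem eqToHom_concatHom {p p' : RedSeq M N} {q q' : RedSeq N P} (h : p = p') (h' : q = q') :
    K.concatHom ρ p q ≫ eqToHom (by rw [h, h']) =
      K.kan.whiskerR (eqToHom (congrArg (K.seq ρ) h)) _ ≫
        K.kan.whiskerL _ (eqToHom (congrArg (K.seq ρ) h')) ≫ K.concatHom ρ p' q' := by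
  subst h h'
  simp

end ExtensionalKanComplex

/-- The induction step for the comparison of the two associations: adding an edge in front. -/
theorem KanStructure.assoc_comparison_step {X : SSet.{u}} [IsKan X] (K : KanStructure X)
    {v w x y z : Simp X 0} (e : SSet.Edge v w) {f : SSet.Edge w x} {g : SSet.Edge x y}
    {h : SSet.Edge y z} {fg : SSet.Edge w y} {gh : SSet.Edge x z} {fgh fgh' : SSet.Edge w z}
    (a : K.comp f g ⟶ fg) (b : K.comp fg h ⟶ fgh) (c : K.comp g h ⟶ gh)
    (d : K.comp f gh ⟶ fgh') (i : fgh ⟶ fgh')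
    (H : K.whiskerR a h ≫ b ≫ i = K.assoc f g h ≫ K.whiskerL f c ≫ d) :
    K.whiskerR (K.assoc e f g ≫ K.whiskerL e a) h ≫ (K.assoc e fg h ≫ K.whiskerL e b) ≫
        K.whiskerL e i =
      K.assoc (K.comp e f) g h ≫ K.whiskerL (K.comp e f) c ≫ K.assoc e f gh ≫
        K.whiskerL e d := by
  have H' := congrArg (K.whiskerL e) H
  simp only [whiskerL_comp] at H'
  -- Naturality moves `a` and `c` past the associators, leaving the two sides of the pentagon for
  -- `e, f, g, h`.
  rw [whiskerR_comp, Category.assoc, Category.assoc, reassoc_of% (K.assoc_naturality_middle e a h),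
    H', reassoc_of% (K.assoc_naturality_right e f c), ← reassoc_of% (K.pentagon e f g h)]

/-! ### Coherence of the shells and of parenthesized composites -/

namespace ExtensionalKanComplex

variable (K : ExtensionalKanComplex.{u}) (ρ : K.Env) {M N P Q R : Term}

/-- Induction on `p`, following the recursion that defines the comparisons. For the empty sequence
the transport is trivial and the left unit laws suffice; a leading edge is handled by
`assoc_comparison_step`. -/
theorem assoc_comparison (p : RedSeq M N) (q : RedSeq N P) (r : RedSeq P Q) :
    K.kan.whiskerR (K.concatHom ρ p q) (K.seq ρ r) ≫ K.concatHom ρ (p.concat q) r ≫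
        eqToHom (congrArg (K.seq ρ) (RedSeq.concat_assoc p q r)) =
      K.kan.assoc (K.seq ρ p) (K.seq ρ q) (K.seq ρ r) ≫
        K.kan.whiskerL (K.seq ρ p) (K.concatHom ρ q r) ≫ K.concatHom ρ p (q.concat r) := by
  induction p with
  | refl M =>
    refine Eq.trans ?_ (congrArg _ (K.kan.leftUnit_naturality (K.concatHom ρ q r)).symm)
    refine Eq.trans ?_ (Category.assoc _ _ _)
    refine Eq.trans ?_ (congrArg (fun t => t ≫ K.concatHom ρ q r)
      (K.kan.leftUnit_comp (K.seq ρ q) (K.seq ρ r)).symm)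
    exact congrArg _ (Category.comp_id _)
  | step s p ih =>
    have H := K.kan.assoc_comparison_step (K.stepEdge ρ s) _ _ _ _ _ (ih q)
    rw [KanStructure.whiskerL_eqToHom, ← concatHom_step, ← concatHom_step, ← concatHom_step] at H
    exact H
  | stepInv s p ih =>
    have H := K.kan.assoc_comparison_step (K.kan.symm (K.stepEdge ρ s)) _ _ _ _ _ (ih q)
    rw [KanStructure.whiskerL_eqToHom, ← concatHom_stepInv, ← concatHom_stepInv,
      ← concatHom_stepInv] at H
    exact H

theorem cls_assocShell (p : RedSeq M N) (q : RedSeq N P) (r : RedSeq P Q) :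
    cls (K.assocShell ρ p q r) = eqToHom (congrArg (K.seq ρ) (RedSeq.concat_assoc p q r)) := by
  have H := K.assoc_comparison ρ p q r
  unfold assocShell
  simp only [KanStructure.cls_vcomp, KanStructure.cls_inv, KanStructure.cls_wr,
    KanStructure.cls_wl, Category.assoc]
  rw [IsIso.inv_comp_eq, Category.assoc]
  exact H.symm

theorem cls_assocEqCell (p : RedSeq M N) (q : RedSeq N P) (r : RedSeq P Q) :
    cls (K.assocEqCell ρ p q r) = eqToHom (congrArg (K.seq ρ) (RedSeq.concat_assoc p q r)) :=
  K.cls_eqCell ρ _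

/-- The class of the comparison of a parenthesized composite with its concatenation. -/
noncomputable def parenHom (t : Paren M N) : K.parenEdge ρ t ⟶ K.seq ρ t.flat :=
  cls (K.parenCell ρ t)

theorem parenHom_node (a : Paren M N) (b : Paren N P) :
    K.parenHom ρ (.node a b) =
      K.kan.whiskerR (K.parenHom ρ a) (K.parenEdge ρ b) ≫
        K.kan.whiskerL (K.seq ρ a.flat) (K.parenHom ρ b) ≫ K.concatHom ρ a.flat b.flat := by
  have H : cls (K.kan.vcomp (K.kan.vcomp (K.kan.wr (K.parenCell ρ a) (K.parenEdge ρ b))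
      (K.kan.wl (K.seq ρ a.flat) (K.parenCell ρ b))) (K.concatCell ρ a.flat b.flat)) =
      K.kan.whiskerR (K.parenHom ρ a) (K.parenEdge ρ b) ≫
        K.kan.whiskerL (K.seq ρ a.flat) (K.parenHom ρ b) ≫ K.concatHom ρ a.flat b.flat := by
    rw [KanStructure.cls_vcomp, KanStructure.cls_vcomp, KanStructure.cls_wr, KanStructure.cls_wl,
      Category.assoc]
    rfl
  exact H

/-- The three naturality laws of the associator and interchange carry the comparisons of `a, b, c`
out of the way, which leaves `assoc_comparison` for the flattened sequences. -/
theorem assoc_parenHom (a : Paren M N) (b : Paren N P) (c : Paren P Q) :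
    K.kan.assoc (K.parenEdge ρ a) (K.parenEdge ρ b) (K.parenEdge ρ c) ≫
        K.parenHom ρ (.node a (.node b c)) =
      K.parenHom ρ (.node (.node a b) c) ≫
        eqToHom (congrArg (K.seq ρ) (Rebracket.assoc a b c).flat_eq) := by
  rw [parenHom_node, parenHom_node, parenHom_node, parenHom_node]
  simp only [parenEdge, Paren.flat, KanStructure.whiskerL_comp, KanStructure.whiskerR_comp,
    Category.assoc]
  rw [← reassoc_of% K.kan.assoc_naturality_left, ← reassoc_of% K.kan.assoc_naturality_middle,
    ← reassoc_of% K.kan.assoc_naturality_right, ← K.assoc_comparison ρ,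
    ← reassoc_of% K.kan.whisker_exchange]

theorem whiskerR_parenHom_node {a a' : Paren M N} (θ : K.parenEdge ρ a ⟶ K.parenEdge ρ a')
    (h : a.flat = a'.flat)
    (H : θ ≫ K.parenHom ρ a' = K.parenHom ρ a ≫ eqToHom (congrArg (K.seq ρ) h))
    (b : Paren N P) :
    K.kan.whiskerR θ (K.parenEdge ρ b) ≫ K.parenHom ρ (.node a' b) =
      K.parenHom ρ (.node a b) ≫ eqToHom (by rw [Paren.flat, Paren.flat, h]) := by
  have E := K.eqToHom_concatHom ρ h (rfl : b.flat = b.flat)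
  rw [eqToHom_refl, KanStructure.whiskerL_id, Category.id_comp] at E
  have G : K.kan.whiskerR θ (K.parenEdge ρ b) ≫ K.kan.whiskerR (K.parenHom ρ a') _ ≫
      K.kan.whiskerL (K.seq ρ a'.flat) (K.parenHom ρ b) ≫ K.concatHom ρ a'.flat b.flat =
      (K.kan.whiskerR (K.parenHom ρ a) _ ≫ K.kan.whiskerL (K.seq ρ a.flat) (K.parenHom ρ b) ≫
        K.concatHom ρ a.flat b.flat) ≫ eqToHom (by rw [h]) := by
    rw [Category.assoc, Category.assoc, E, ← reassoc_of% K.kan.whisker_exchange,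
      ← reassoc_of% K.kan.whiskerR_comp, H, KanStructure.whiskerR_comp, Category.assoc]
  rw [parenHom_node, parenHom_node]
  exact G

theorem whiskerL_parenHom_node (a : Paren M N) {b b' : Paren N P}
    (θ : K.parenEdge ρ b ⟶ K.parenEdge ρ b') (h : b.flat = b'.flat)
    (H : θ ≫ K.parenHom ρ b' = K.parenHom ρ b ≫ eqToHom (congrArg (K.seq ρ) h)) :
    K.kan.whiskerL (K.parenEdge ρ a) θ ≫ K.parenHom ρ (.node a b') =
      K.parenHom ρ (.node a b) ≫ eqToHom (by rw [Paren.flat, Paren.flat, h]) := by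
  have E := K.eqToHom_concatHom ρ (rfl : a.flat = a.flat) h
  rw [eqToHom_refl, KanStructure.whiskerR_id, Category.id_comp] at E
  have G : K.kan.whiskerL (K.parenEdge ρ a) θ ≫ K.kan.whiskerR (K.parenHom ρ a) _ ≫
      K.kan.whiskerL (K.seq ρ a.flat) (K.parenHom ρ b') ≫ K.concatHom ρ a.flat b'.flat =
      (K.kan.whiskerR (K.parenHom ρ a) _ ≫ K.kan.whiskerL (K.seq ρ a.flat) (K.parenHom ρ b) ≫
        K.concatHom ρ a.flat b.flat) ≫ eqToHom (by rw [h]) := by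
    rw [Category.assoc, Category.assoc, E, ← reassoc_of% K.kan.whisker_exchange,
      ← reassoc_of% K.kan.whiskerL_comp, H, KanStructure.whiskerL_comp, Category.assoc]
  rw [parenHom_node, parenHom_node]
  exact G

/-- The square to be checked is stable under whiskering and inversion, so it propagates from the
bare associator to a rebracketing at any place. -/
theorem rebracketCell_parenHom {t t' : Paren M N} (m : Rebracket t t') :
    cls (K.rebracketCell ρ m) ≫ K.parenHom ρ t' =
      K.parenHom ρ t ≫ eqToHom (congrArg (K.seq ρ) m.flat_eq) := by
  induction m with
  | assoc a b c => exact K.assoc_parenHom ρ a b c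
  | assocInv a b c =>
    have E : cls (K.rebracketCell ρ (.assocInv a b c)) =
        CategoryTheory.inv (cls (K.rebracketCell ρ (.assoc a b c))) := K.kan.cls_inv _
    have H : cls (K.rebracketCell ρ (.assoc a b c)) ≫ _ = _ := K.assoc_parenHom ρ a b c
    rw [E, IsIso.inv_comp_eq, reassoc_of% H, eqToHom_trans, eqToHom_refl, Category.comp_id]
  | left m b ih =>
    refine (congrArg (fun t => t ≫ _) (K.kan.cls_wr _ _)).trans ?_
    exact K.whiskerR_parenHom_node ρ _ m.flat_eq ih b
  | right a m ih =>
    refine (congrArg (fun t => t ≫ _) (K.kan.cls_wl _ _)).trans ?_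
    exact K.whiskerL_parenHom_node ρ a _ m.flat_eq ih

theorem cls_parenShell {t t' : Paren M N} (θ : Cell₂ (K.parenEdge ρ t) (K.parenEdge ρ t'))
    (h : t.flat = t'.flat)
    (H : cls θ ≫ K.parenHom ρ t' = K.parenHom ρ t ≫ eqToHom (congrArg (K.seq ρ) h)) :
    cls (K.parenShell ρ θ) = cls (K.eqCell ρ h) := by
  unfold parenShell
  rw [KanStructure.cls_vcomp, KanStructure.cls_vcomp, KanStructure.cls_inv, cls_eqCell,
    Category.assoc, IsIso.inv_comp_eq]
  exact H

theorem chainCell_parenHom {t t' : Paren M N} (c : RebracketChain t t') :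
    cls (K.chainCell ρ c) ≫ K.parenHom ρ t' =
      K.parenHom ρ t ≫ eqToHom (congrArg (K.seq ρ) c.flat_eq) := by
  induction c with
  | nil t => exact (Category.id_comp _).trans (Category.comp_id _).symm
  | cons m c ih =>
    rw [chainCell, KanStructure.cls_vcomp, Category.assoc, ih,
      reassoc_of% K.rebracketCell_parenHom ρ m, eqToHom_trans]

/-! ### The structural pentagon and the four boundaries of the syntactic pentagon -/

theorem cls_pentagonL_eq {a b c d e : Simp K.X 0} (p : SSet.Edge a b) (q : SSet.Edge b c)
    (r : SSet.Edge c d) (s : SSet.Edge d e) :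
    cls (K.kan.pentagonL p q r s) = cls (K.kan.pentagonR p q r s) := by
  unfold KanStructure.pentagonL KanStructure.pentagonR
  simp only [KanStructure.cls_vcomp, KanStructure.cls_wr, KanStructure.cls_wl, Category.assoc]
  exact K.kan.pentagon p q r s

/-- After substituting the equality, the whiskered identity is conjugated by a comparison cell and
collapses; likewise on the right. -/
theorem cls_seqWl_of_eq (p : RedSeq M N) {q q' : RedSeq N P}
    (θ : Cell₂ (K.seq ρ q) (K.seq ρ q')) (h : q = q')
    (H : cls θ = eqToHom (congrArg (K.seq ρ) h)) :
    cls (K.seqWl ρ p θ) = eqToHom (congrArg (fun t => K.seq ρ (p.concat t)) h) := by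
  subst h
  rw [eqToHom_refl] at H
  unfold seqWl
  rw [KanStructure.cls_vcomp, KanStructure.cls_vcomp, KanStructure.cls_inv,
    KanStructure.cls_wl, H]
  simp

theorem cls_seqWr_of_eq {p p' : RedSeq M N} (θ : Cell₂ (K.seq ρ p) (K.seq ρ p')) (h : p = p')
    (H : cls θ = eqToHom (congrArg (K.seq ρ) h)) (q : RedSeq N P) :
    cls (K.seqWr ρ θ q) = eqToHom (congrArg (fun t => K.seq ρ (RedSeq.concat t q)) h) := by
  subst h
  rw [eqToHom_refl] at H
  unfold seqWr
  rw [KanStructure.cls_vcomp, KanStructure.cls_vcomp, KanStructure.cls_inv,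
    KanStructure.cls_wr, H]
  simp

section Pentagon

variable (p : RedSeq M N) (q : RedSeq N P) (r : RedSeq P Q) (s : RedSeq Q R)

/-- Both bracketings flatten to the same sequence. As `eqToHom` does not depend on the proof of
equality, this fixes one common value for all four boundaries. -/
theorem pentagon_flat_eq :
    K.seq ρ (((p.concat q).concat r).concat s) = K.seq ρ (p.concat (q.concat (r.concat s))) := by
  rw [RedSeq.concat_assoc, RedSeq.concat_assoc]

theorem cls_homotopy₂_pentagonSource :
    cls (K.homotopy₂ ρ (pentagonSource p q r s)) = eqToHom (K.pentagon_flat_eq ρ p q r s) := by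
  simp only [pentagonSource, homotopy₂]
  rw [KanStructure.cls_vcomp, cls_assocEqCell, cls_assocEqCell, eqToHom_trans]

theorem cls_homotopy₂_pentagonTarget :
    cls (K.homotopy₂ ρ (pentagonTarget p q r s)) = eqToHom (K.pentagon_flat_eq ρ p q r s) := by
  simp only [pentagonTarget, homotopy₂]
  rw [KanStructure.cls_vcomp, KanStructure.cls_vcomp, cls_assocEqCell,
    K.cls_seqWr_of_eq ρ _ (RedSeq.concat_assoc p q r)
      (K.cls_assocEqCell ρ p q r),
    K.cls_seqWl_of_eq ρ _ _ (RedSeq.concat_assoc q r s) (K.cls_assocEqCell ρ q r s), eqToHom_trans, eqToHom_trans]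

theorem cls_sourceShell :
    cls (K.sourceShell ρ p q r s) = eqToHom (K.pentagon_flat_eq ρ p q r s) := by
  unfold sourceShell
  rw [KanStructure.cls_vcomp, cls_assocShell, cls_assocShell, eqToHom_trans]

theorem cls_mixedTargetShell :
    cls (K.mixedTargetShell ρ p q r s) = eqToHom (K.pentagon_flat_eq ρ p q r s) := by
  unfold mixedTargetShell
  rw [KanStructure.cls_vcomp, KanStructure.cls_vcomp, cls_assocShell, cls_eqCell,
    K.cls_seqWl_of_eq ρ _ _ (RedSeq.concat_assoc q r s) (K.cls_assocShell ρ q r s), eqToHom_trans, eqToHom_trans]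

end Pentagon

end ExtensionalKanComplex

end HigherLambda

open HigherLambda

theorem theoremB (K : FrontSeedCoherentExtensionalKanComplex.{u}) :
    -- (i) the structural associator shell is connected to the equality-generated comparison,
    ((∀ (M N P Q : Term) (p : RedSeq M N) (q : RedSeq N P) (r : RedSeq P Q) (ρ : K.Env),
        Nonempty (Cell₃ (K.assocShell ρ p q r) (K.assocEqCell ρ p q r))) ∧
      -- and any two parenthesizations are connected by chains of such comparisons
      (∀ (M N : Term) (t t' : Paren M N), t.factors = t'.factors →
        Nonempty (RebracketChain t t')) ∧
      (∀ (M N : Term) (t t' : Paren M N) (m : Rebracket t t') (ρ : K.Env),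
        Nonempty (Cell₃ (K.parenShell ρ (K.rebracketCell ρ m)) (K.eqCell ρ m.flat_eq))) ∧
      (∀ (M N : Term) (t t' : Paren M N) (c : RebracketChain t t') (ρ : K.Env),
        Nonempty (Cell₃ (K.parenShell ρ (K.chainCell ρ c)) (K.eqCell ρ c.flat_eq)))) ∧
    -- (ii) the structural semantic pentagon
    (∀ (M N P Q R : Term) (p : RedSeq M N) (q : RedSeq N P) (r : RedSeq P Q) (s : RedSeq Q R)
        (ρ : K.Env),
      Nonempty (Cell₃ (K.kan.pentagonL (K.seq ρ p) (K.seq ρ q) (K.seq ρ r) (K.seq ρ s))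
        (K.kan.pentagonR (K.seq ρ p) (K.seq ρ q) (K.seq ρ r) (K.seq ρ s)))) ∧
    -- (iii) the interpreted syntactic pentagon, its source and target bridges, the shell bridge
    (∀ (M N P Q R : Term) (p : RedSeq M N) (q : RedSeq N P) (r : RedSeq P Q) (s : RedSeq Q R)
        (ρ : K.Env),
      Nonempty (Cell₃ (K.homotopy₂ ρ (pentagonSource p q r s))
        (K.homotopy₂ ρ (pentagonTarget p q r s))) ∧
      Nonempty (Cell₃ (K.homotopy₂ ρ (pentagonSource p q r s)) (K.sourceShell ρ p q r s)) ∧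
      Nonempty (Cell₃ (K.homotopy₂ ρ (pentagonTarget p q r s))
        (K.mixedTargetShell ρ p q r s)) ∧
      Nonempty (Cell₃ (K.sourceShell ρ p q r s) (K.mixedTargetShell ρ p q r s))) := by
  -- Apart from the existence of chains, each claim becomes an equality of classes of 2-cells.
  refine ⟨⟨fun M N P Q p q r ρ => ?_, fun M N t t' h => RebracketChain.nonempty_of_factors_eq h,
    fun M N t t' m ρ => ?_, fun M N t t' c ρ => ?_⟩, fun M N P Q R p q r s ρ => ?_,
    fun M N P Q R p q r s ρ => ⟨?_, ?_, ?_, ?_⟩⟩ <;> rw [nonempty_cell₃_iff]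
  · rw [K.cls_assocShell, K.cls_assocEqCell]
  · exact K.cls_parenShell ρ _ _ (K.rebracketCell_parenHom ρ m)
  · exact K.cls_parenShell ρ _ _ (K.chainCell_parenHom ρ c)
  · exact K.cls_pentagonL_eq _ _ _ _
  · rw [K.cls_homotopy₂_pentagonSource, K.cls_homotopy₂_pentagonTarget]
  · rw [K.cls_homotopy₂_pentagonSource, K.cls_sourceShell]
  · rw [K.cls_homotopy₂_pentagonTarget, K.cls_mixedTargetShell]
  · rw [K.cls_sourceShell, K.cls_mixedTargetShell]
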